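/- Let $d\in\mathbb{N}$ and let $\mathbb{V}$ be a separable complex Hilbert space. Let $\mathbb{T}$ denote the trace-class operators on $\mathbb{V}$, i.e. the bounded operators $T$ with $\|T\|_{\rm tr}=\sum_j\langle (T^*T)^{1/2}e_j,e_j\rangle<\infty$ for a (equivalently, any) complete orthonormal system $(e_j)$, and let $\mathbb{T}_+\subset\mathbb{T}$ be the positive ones. Write $\mathcal{T}\ge 0$ when $\mathcal{T}$ is a positive operator. A family $\{\mathcal{K}(t)\}_{t\in\mathbb{R}^d}$ of operators on $\mathbb{V}$ is called *weakly positive definite* if $$\sum_{j=1}^n\sum_{j'=1}^n c_j\overline{c_{j'}}\,\mathcal{K}(t_j-t_{j'})\ge 0\qquad\text{for all } n,\ c_j\in\mathbb{C},\ t_j\in\mathbb{R}^d,$$ and *completely positive definite* if $$\sum_{j=1}^n\sum_{j'=1}^n\langle f_j,\mathcal{K}(t_j-t_{j'})f_{j'}\rangle\ge 0\qquad\text{for all } n,\ f_j\in\mathbb{V},\ t_j\in\mathbb{R}^d.$$ A *finite $\mathbb{T}_+$-valued measure* is a map $\mu$ from the Borel sets of $\mathbb{R}^d$ to $\mathbb{T}_+$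 that is countably additive in the trace norm. For a nonnegative simple function $f=\sum_i c_i 1_{A_i}$ (with the $A_i$ disjoint Borel sets) put $\int f\,d\mu=\sum_i c_i\mu(A_i)$. For a nonnegative measurable $f$ let $\int f\,d\mu$ be the trace-norm limit of $\int f_n\,d\mu$, where $f_n\uparrow f$ pointwise, the $f_n$ are nonnegative simple functions, and $\int f_n\,d\mu\le\mathcal{B}$ for all $n$ and some fixed $\mathcal{B}\in\mathbb{T}_+$. For complex $f$ the integral is defined through the positive and negative parts of the real and imaginary parts of $f$. 1. Let $\mathcal{K}:\mathbb{R}^d\to\mathbb{T}$ be weakly positive definite with $\|\mathcal{K}(t)-\mathcal{K}(0)\|_{\rm tr}\to0$ as $t\to0$. Then there is a unique finite $\mathbb{T}_+$-valued measure $\mu$ such that $$\mathcal{K}(t)=\int_{\mathbb{R}^d}e^{i\,t^\top x}\,\mu(dx)\qquad\text{for all } t\in\mathbb{R}^d.\tag{$*$}$$ 2. Conversely, for every finite $\mathbb{T}_+$-valued measure $\mu$ the integrals in $(*)$ are well defined for all $t\in\mathbb{R}^d$, and $(*)$ yields a family of trace-class operators that is weakly, and even completely, positive definite. 3. Let $\mathcal{K}:\mathbb{R}^d\to\mathbb{T}$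 satisfy $\|\mathcal{K}(t)-\mathcal{K}(0)\|_{\rm tr}\to0$ as $t\to0$. Then $\mathcal{K}$ is weakly positive definite if and only if it is completely positive definite. -/

import Mathlib

open MeasureTheory Filter Topology
open scoped ENNReal NNReal ComplexOrder InnerProductSpace

noncomputable section

namespace OperatorBochner

section TraceClass

variable {V : Type*} [NormedAddCommGroup V] [InnerProductSpace ℂ V] [CompleteSpace V]

/-- The sum `∑ⱼ ⟨(T* T)^{1/2} eⱼ, eⱼ⟩ ∈ [0, ∞]` along a complete orthonormal system `(eⱼ)`.
Each term is a nonnegative real number because `(T* T)^{1/2}` is a positive operator. -/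
def traceNormAlong {ι : Type*} (b : HilbertBasis ι ℂ V) (T : V →L[ℂ] V) : ℝ≥0∞ :=
  ∑' j, ENNReal.ofReal (⟪CFC.sqrt (star T * T) (b j), b j⟫_ℂ).re

/-- The index set of a fixed complete orthonormal system of `V`. -/
def onbIndex (V : Type*) [NormedAddCommGroup V] [InnerProductSpace ℂ V] [CompleteSpace V] :
    Set V :=
  (exists_hilbertBasis ℂ V).choose

/-- A fixed complete orthonormal system of `V`. -/
def onb (V : Type*) [NormedAddCommGroup V] [InnerProductSpace ℂ V] [CompleteSpace V] :
    HilbertBasis (onbIndex V) ℂ V :=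
  (exists_hilbertBasis ℂ V).choose_spec.choose

/-- The trace norm `‖T‖_tr ∈ [0, ∞]` of a bounded operator. It does not depend on the complete
orthonormal system, see `traceNorm_eq`. -/
def traceNorm (T : V →L[ℂ] V) : ℝ≥0∞ :=
  traceNormAlong (onb V) T

/-- Parseval's identity in `[0, ∞]`. -/
theorem tsum_ofReal_norm_inner_sq {V : Type*} [NormedAddCommGroup V] [InnerProductSpace ℂ V]
    {ι : Type*} (b : HilbertBasis ι ℂ V) (x : V) :
    ∑' j, ENNReal.ofReal (‖⟪b j, x⟫_ℂ‖ ^ 2) = ENNReal.ofReal (‖x‖ ^ 2) := by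
  have h2 : HasSum (fun j => ‖⟪b j, x⟫_ℂ‖ ^ 2) (‖x‖ ^ 2) := by
    have h3 := Complex.hasSum_re (b.hasSum_inner_mul_inner x x)
    convert h3 using 1
    · funext j
      rw [← inner_conj_symm x (b j), ← Complex.normSq_eq_conj_mul_self, Complex.ofReal_re,
        Complex.normSq_eq_norm_sq]
    · rw [inner_self_eq_norm_sq_to_K]
      norm_cast
  rw [← ENNReal.ofReal_tsum_of_nonneg (fun j => by positivity) h2.summable, h2.tsum_eq]

/-- The sum defining the trace norm as a double sum over two complete orthonormal systems. -/
theorem traceNormAlong_eq_tsum {ι κ : Type*} (e : HilbertBasis ι ℂ V) (f : HilbertBasis κ ℂ V)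
    (T : V →L[ℂ] V) :
    traceNormAlong e T = ∑' j, ∑' k,
      ENNReal.ofReal (‖⟪f k, CFC.sqrt (CFC.sqrt (star T * T)) (e j)⟫_ℂ‖ ^ 2) := by
  refine tsum_congr fun j => ?_
  rw [tsum_ofReal_norm_inner_sq]
  set A : V →L[ℂ] V := CFC.sqrt (star T * T)
  have hSS : CFC.sqrt A * CFC.sqrt A = A := CFC.sqrt_mul_sqrt_self A (CFC.sqrt_nonneg _)
  have hsym := ((ContinuousLinearMap.nonneg_iff_isPositive (CFC.sqrt A)).1
    (CFC.sqrt_nonneg _)).isSymmetric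
  have h1 : A (e j) = CFC.sqrt A (CFC.sqrt A (e j)) := congrArg (fun B : V →L[ℂ] V => B (e j)) hSS.symm
  have h2 : ⟪CFC.sqrt A (CFC.sqrt A (e j)), e j⟫_ℂ = ⟪CFC.sqrt A (e j), CFC.sqrt A (e j)⟫_ℂ :=
    hsym _ _
  rw [h1, h2, inner_self_eq_norm_sq_to_K]
  norm_cast

/-- The value of the sum defining the trace norm is the same for all complete orthonormal
systems. -/
theorem traceNorm_eq {ι : Type*} (b : HilbertBasis ι ℂ V) (T : V →L[ℂ] V) :
    traceNorm T = traceNormAlong b T := by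
  have hsym := ((ContinuousLinearMap.nonneg_iff_isPositive
    (CFC.sqrt (CFC.sqrt (star T * T)))).1 (CFC.sqrt_nonneg _)).isSymmetric
  rw [traceNorm, traceNormAlong_eq_tsum (onb V) b, traceNormAlong_eq_tsum b (onb V),
    ENNReal.tsum_comm]
  refine tsum_congr fun k => tsum_congr fun j => ?_
  rw [norm_inner_symm]
  exact congrArg (fun z : ℂ => ENNReal.ofReal (‖z‖ ^ 2)) (hsym (onb V j) (b k))

/-- Trace-class operators: bounded operators with finite trace norm. -/
def IsTraceClass (T : V →L[ℂ] V) : Prop :=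
  traceNorm T < ∞

end TraceClass

section PositiveDefinite

variable {G V : Type*} [AddGroup G] [NormedAddCommGroup V] [InnerProductSpace ℂ V]
  [CompleteSpace V]

/-- Positive definiteness in the weak sense: `∑ⱼ ∑ₖ cⱼ c̄ₖ K(tⱼ - tₖ)` is a positive operator for
all scalars `cⱼ` and all points `tⱼ`. -/
def WeaklyPositiveDefinite (K : G → V →L[ℂ] V) : Prop :=
  ∀ (n : ℕ) (c : Fin n → ℂ) (t : Fin n → G),
    (∑ j, ∑ k, (c j * star (c k)) • K (t j - t k)).IsPositive

/-- Complete positive definiteness: `∑ⱼ ∑ₖ ⟨fⱼ, K(tⱼ - tₖ) fₖ⟩` is a nonnegative real number for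
all vectors `fⱼ` and all points `tⱼ`. -/
def CompletelyPositiveDefinite (K : G → V →L[ℂ] V) : Prop :=
  ∀ (n : ℕ) (f : Fin n → V) (t : Fin n → G),
    0 ≤ ∑ j, ∑ k, ⟪f j, K (t j - t k) (f k)⟫_ℂ

end PositiveDefinite

section Measure

/-- A measure on `α` with values in the positive trace-class operators on `V`: a map from the
measurable sets to these operators that is countably additive in the trace norm. Such a measure is
automatically finite, `0 ≤ μ A ≤ μ α`. As for Mathlib's vector measures, non-measurable sets get
the value `0`, so that two such measures are equal as soon as they agree on measurable sets. -/
@[ext]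
structure PosTraceClassMeasure (α : Type*) [MeasurableSpace α] (V : Type*)
    [NormedAddCommGroup V] [InnerProductSpace ℂ V] [CompleteSpace V] where
  toFun : Set α → V →L[ℂ] V
  isPositive : ∀ A, MeasurableSet A → (toFun A).IsPositive
  isTraceClass : ∀ A, MeasurableSet A → IsTraceClass (toFun A)
  not_measurable : ∀ A, ¬ MeasurableSet A → toFun A = 0
  iUnion : ∀ A : ℕ → Set α, (∀ i, MeasurableSet (A i)) →
    (∀ i j, i ≠ j → Disjoint (A i) (A j)) →
      Tendsto (fun n => traceNorm (∑ i ∈ Finset.range n, toFun (A i) - toFun (⋃ i, A i)))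
        atTop (𝓝 0)

variable {α : Type*} [MeasurableSpace α] {V : Type*} [NormedAddCommGroup V]
  [InnerProductSpace ℂ V] [CompleteSpace V]

/-- The integral `∑ c μ(f = c)` of a nonnegative simple function. -/
def simpleIntegral (μ : PosTraceClassMeasure α V) (f : SimpleFunc α ℝ≥0) : V →L[ℂ] V :=
  ∑ c ∈ f.range, ((c : ℝ) : ℂ) • μ.toFun (f ⁻¹' {c})

/-- `T` is the integral of the nonnegative function `f`: the limit in trace norm of the integrals
of simple functions that increase to `f` and whose integrals are bounded above, as operators, by
one positive trace-class operator. -/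
def HasNonnegIntegral (μ : PosTraceClassMeasure α V) (f : α → ℝ≥0) (T : V →L[ℂ] V) : Prop :=
  IsTraceClass T ∧ ∃ F : ℕ → SimpleFunc α ℝ≥0,
    Monotone F ∧
    (∀ x, Tendsto (fun n => F n x) atTop (𝓝 (f x))) ∧
    (∃ B : V →L[ℂ] V, B.IsPositive ∧ IsTraceClass B ∧
      ∀ n, (B - simpleIntegral μ (F n)).IsPositive) ∧
    Tendsto (fun n => traceNorm (simpleIntegral μ (F n) - T)) atTop (𝓝 0)

/-- `T = ∫ f dμ` for a complex function `f`, through the positive and negative parts of its real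
and imaginary parts (all four of which have to be integrable). -/
def HasIntegral (μ : PosTraceClassMeasure α V) (f : α → ℂ) (T : V →L[ℂ] V) : Prop :=
  ∃ R₁ R₂ I₁ I₂ : V →L[ℂ] V,
    HasNonnegIntegral μ (fun x => (f x).re.toNNReal) R₁ ∧
    HasNonnegIntegral μ (fun x => (-(f x).re).toNNReal) R₂ ∧
    HasNonnegIntegral μ (fun x => (f x).im.toNNReal) I₁ ∧
    HasNonnegIntegral μ (fun x => (-(f x).im).toNNReal) I₂ ∧
    T = (R₁ - R₂) + Complex.I • (I₁ - I₂)

end Measure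

/-- The character `x ↦ e^{i t·x}` of `ℝ^d`. -/
def expChar {d : ℕ} (t x : EuclideanSpace ℝ (Fin d)) : ℂ :=
  Complex.exp (Complex.I * ((⟪t, x⟫_ℝ : ℝ) : ℂ))

end OperatorBochner

end

/-! For fixed `v` the function `t ↦ ⟪v, K t v⟫` is positive definite and continuous at 0, so
Bochner's theorem (`IsPosDef.exists_charFun_eq`) gives a finite measure `m v` with this
characteristic function. The issue is to assemble the `m v` into one operator-valued measure.

A finite linear relation in `v` that holds for the quadratic forms of all bounded operators holds
for those of every `K t`, hence for the characteristic functions of the `m v`, hence, since these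
determine a measure, for the numbers `m v A`. Sesquilinearity of the polarization consists of such
relations, so `v ↦ m v A` polarizes to a sesquilinear form. It is bounded because `m v A ≤ ⟪v, K 0
v⟫`, and therefore comes from an operator `μ A` (`IsOperatorForm.exists_operator`). The trace norm
of a positive operator is the sum of its diagonal entries, so `A ↦ ‖μ A‖_tr` is the scalar measure
`∑ⱼ m eⱼ`, finite because `K 0` is trace class. Countable additivity in trace norm is then
continuity from above of that measure (`exists_posTraceClassMeasure`).

The converse uses the same two devices: a bounded function is integrated weakly, through its scalar
integrals, and trace-norm convergence is dominated convergence against `tr μ`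
(`exists_hasNonnegIntegral`). Complete positivity reduces, by simple functions, to positivity of
each `μ A`. Weak positivity implies complete positivity by passing through the representing measure.
-/

noncomputable section

namespace OperatorBochner

/-! ### Scalar positive definite functions: Krein's inequality and double integrals. -/

section PositiveDefiniteFunctions

/-- Positive definite complex functions on an additive group. -/
def IsPosDef {G : Type*} [AddGroup G] (φ : G → ℂ) : Prop :=
  ∀ (n : ℕ) (c : Fin n → ℂ) (t : Fin n → G),
    0 ≤ ∑ j, ∑ k, c j * star (c k) * φ (t j - t k)

theorem IsPosDef.zero_nonneg {G : Type*} [AddGroup G] {φ : G → ℂ} (h : IsPosDef φ) :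
    0 ≤ φ 0 := by
  simpa using h 1 (fun _ => 1) (fun _ => 0)

theorem IsPosDef.zero_eq {G : Type*} [AddGroup G] {φ : G → ℂ} (h : IsPosDef φ) :
    φ 0 = ((φ 0).re : ℂ) :=
  Complex.ext rfl (Complex.nonneg_iff.1 h.zero_nonneg).2.symm

theorem IsPosDef.neg {G : Type*} [AddGroup G] {φ : G → ℂ} (h : IsPosDef φ) (t : G) :
    φ (-t) = star (φ t) := by
  have h0 := (Complex.nonneg_iff.1 h.zero_nonneg).2
  -- Imaginary parts vanish: the coefficients (1, 1) compare the imaginary parts of `φ t` and `φ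
  -- (-t)`, and (1, i) their real parts.
  have h1 := (Complex.nonneg_iff.1 (h 2 ![1, 1] ![t, 0])).2
  have h2 := (Complex.nonneg_iff.1 (h 2 ![1, Complex.I] ![t, 0])).2
  simp [Fin.sum_univ_two, ← h0] at h1 h2
  apply Complex.ext
  · simp; linarith
  · simp; linarith

/-- **Krein's inequality** in quadratic form. -/
theorem IsPosDef.quadratic_nonneg {G : Type*} [AddGroup G] {φ : G → ℂ} (h : IsPosDef φ)
    (s t : G) (x : ℝ) :
    0 ≤ (φ 0).re * (x * x) + (-2 * ‖φ t - φ s‖) * x + 2 * ((φ 0).re - (φ (t - s)).re) := by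
  obtain ⟨z, hz, hz'⟩ : ∃ z : ℂ, ‖z‖ = 1 ∧ z * (φ t - φ s) = (‖φ t - φ s‖ : ℂ) := by
    by_cases hd : φ t - φ s = 0
    · exact ⟨1, by simp, by simp [hd]⟩
    · refine ⟨star (φ t - φ s) / ‖φ t - φ s‖, ?_, ?_⟩
      · rw [norm_div, norm_star, Complex.norm_real, norm_norm, div_self (norm_ne_zero_iff.2 hd)]
      · have : (‖φ t - φ s‖ : ℂ) ≠ 0 := by simpa using hd
        rw [div_mul_eq_mul_div, div_eq_iff this, Complex.star_def, ← Complex.normSq_eq_conj_mul_self,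
          Complex.normSq_eq_norm_sq]
        push_cast; ring
  have hzz : z * star z = 1 := by
    rw [Complex.star_def, Complex.mul_conj, Complex.normSq_eq_norm_sq, hz]; simp
  -- The phase `z` turns both cross terms into `x * ‖φ t - φ s‖`; the real `x` stays free so that a
  -- discriminant can be taken later.
  have h3 := h 3 ![z, -z, -x] ![t, s, 0]
  have e1 : ∑ j, ∑ k, ![z, -z, -(x : ℂ)] j * star (![z, -z, -(x : ℂ)] k) *
      φ (![t, s, 0] j - ![t, s, 0] k) =
      z * star z * (φ 0 + φ 0 - φ (t - s) - star (φ (t - s))) + x ^ 2 * φ 0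
        - x * (z * (φ t - φ s)) - x * star (z * (φ t - φ s)) := by
    have hst : φ (s - t) = star (φ (t - s)) := by rw [← h.neg, neg_sub]
    simp only [Fin.sum_univ_three, Matrix.cons_val_zero, Matrix.cons_val_one,
      Matrix.cons_val, sub_self, sub_zero, zero_sub, h.neg, hst, star_neg, star_mul, star_sub]
    simp only [Complex.star_def, Complex.conj_ofReal]
    ring
  rw [e1, hzz, hz'] at h3
  have h4 := (Complex.nonneg_iff.1 h3).1
  have h5 : (x ^ 2 * φ 0).re = x ^ 2 * (φ 0).re := by
    rw [← Complex.ofReal_pow, Complex.re_ofReal_mul]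
  simp only [Complex.add_re, Complex.sub_re, one_mul, h5, Complex.star_def, Complex.conj_re,
    Complex.conj_ofReal, Complex.re_ofReal_mul, Complex.ofReal_re] at h4
  linarith

/-- **Krein's inequality**. -/
theorem IsPosDef.norm_sub_sq_le {G : Type*} [AddGroup G] {φ : G → ℂ} (h : IsPosDef φ) (s t : G) :
    ‖φ t - φ s‖ ^ 2 ≤ 2 * (φ 0).re * ((φ 0).re - (φ (t - s)).re) := by
  have := discrim_le_zero (h.quadratic_nonneg s t)
  rw [discrim] at this
  nlinarith

/-- With a phase `z` such that `z * φ t = ‖φ t‖`, the coefficients (z, -1) at the points (t, 0) give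
`2 φ 0 - 2 ‖φ t‖ ≥ 0`. -/
theorem IsPosDef.norm_le {G : Type*} [AddGroup G] {φ : G → ℂ} (h : IsPosDef φ) (t : G) :
    ‖φ t‖ ≤ (φ 0).re := by
  obtain ⟨z, hz, hz'⟩ : ∃ z : ℂ, z * star z = 1 ∧ z * (φ t) = (‖φ t‖ : ℂ) := by
    by_cases hd : φ t = 0
    · exact ⟨1, by simp, by simp [hd]⟩
    · have : (‖φ t‖ : ℂ) ≠ 0 := by simpa using hd
      have e : star (φ t) * φ t = ‖φ t‖ * ‖φ t‖ := by
        rw [Complex.star_def, ← Complex.normSq_eq_conj_mul_self, Complex.normSq_eq_norm_sq]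
        push_cast; ring
      refine ⟨star (φ t) / ‖φ t‖, ?_, ?_⟩
      · rw [star_div₀, star_star, show star (‖φ t‖ : ℂ) = ‖φ t‖ from Complex.conj_ofReal _, div_mul_div_comm,
          e, div_self (mul_ne_zero this this)]
      · rw [div_mul_eq_mul_div, div_eq_iff this, e]
  have h3 := h 2 ![z, -1] ![t, 0]
  have e1 : ∑ j, ∑ k, ![z, -1] j * star (![z, -1] k) * φ (![t, 0] j - ![t, 0] k) =
      z * star z * φ 0 + φ 0 - z * φ t - star (z * φ t) := by
    simp only [Fin.sum_univ_two, Matrix.cons_val_zero, Matrix.cons_val_one,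
      sub_self, sub_zero, zero_sub, h.neg, star_neg, star_mul, star_one]
    ring
  rw [e1, hz, hz'] at h3
  have h4 := (Complex.nonneg_iff.1 h3).1
  simp only [Complex.add_re, Complex.sub_re, one_mul, Complex.star_def,
    Complex.conj_ofReal, Complex.ofReal_re] at h4
  linarith

theorem IsPosDef.continuous {G : Type*} [AddGroup G] [TopologicalSpace G] [IsTopologicalAddGroup G]
    {φ : G → ℂ} (h : IsPosDef φ) (hc : ContinuousAt φ 0) : Continuous φ := by
  rw [continuous_iff_continuousAt]
  intro s
  have h1 : Tendsto (fun t => φ (t - s)) (𝓝 s) (𝓝 (φ 0)) := by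
    refine hc.tendsto.comp ?_
    exact (by fun_prop : Continuous fun t => t - s).tendsto' _ _ (sub_self s)
  have h2 : Tendsto (fun t => Real.sqrt (2 * (φ 0).re * ((φ 0).re - (φ (t - s)).re))) (𝓝 s) (𝓝 0) := by
    have h3 : Tendsto (fun t => (φ (t - s)).re) (𝓝 s) (𝓝 (φ 0).re) :=
      (Complex.continuous_re.tendsto _).comp h1
    have h4 := ((tendsto_const_nhds (x := (φ 0).re)).sub h3).const_mul (2 * (φ 0).re)
    have := (Real.continuous_sqrt.tendsto _).comp h4
    simpa [Function.comp_def] using this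
  rw [ContinuousAt, tendsto_iff_norm_sub_tendsto_zero]
  refine squeeze_zero (fun _ => norm_nonneg _) (fun t => ?_) h2
  exact Real.le_sqrt_of_sq_le (h.norm_sub_sq_le s t)

theorem IsPosDef.mul_char {E : Type*} [NormedAddCommGroup E] [InnerProductSpace ℝ E] {φ : E → ℂ}
    (h : IsPosDef φ) (ξ : E) :
    IsPosDef fun t => Complex.exp ((⟪t, ξ⟫_ℝ : ℝ) * Complex.I) * φ t := by
  intro n c t
  convert h n (fun j => c j * Complex.exp ((⟪t j, ξ⟫_ℝ : ℝ) * Complex.I)) t using 3 with j _ k _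
  simp only [star_mul, Complex.star_def, ← Complex.exp_conj, inner_sub_left, map_mul,
    Complex.conj_ofReal, Complex.conj_I, Complex.ofReal_sub, sub_mul, Complex.exp_sub, mul_neg,
    Complex.exp_neg]
  field_simp

/-- Draw `n` independent points from `ν` and average the defining inequality with all coefficients
1. The diagonal contributes `n φ 0`, the off-diagonal pairs `n (n - 1) J`. Dividing by `n²` and
letting `n → ∞` leaves `J ≥ 0`. -/
theorem IsPosDef.integral_nonneg {G : Type*} [AddGroup G] [MeasurableSpace G] [MeasurableSub₂ G]
    {φ : G → ℂ} (h : IsPosDef φ) (hm : Measurable φ) (ν : Measure G) [IsProbabilityMeasure ν] :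
    0 ≤ ∫ p : G × G, φ (p.1 - p.2) ∂(ν.prod ν) := by
  set J := ∫ p : G × G, φ (p.1 - p.2) ∂(ν.prod ν) with hJ
  have key : ∀ n : ℕ, 0 ≤ (n : ℂ) * φ 0 + (n : ℂ) * ((n : ℂ) - 1) * J := by
    intro n
    let P := Measure.pi (fun _ : Fin n => ν)
    have hint : ∀ j k : Fin n, Integrable (fun x : Fin n → G => φ (x j - x k)) P := fun j k =>
      Integrable.of_bound (C := (φ 0).re)
        (hm.comp ((measurable_pi_apply j).sub (measurable_pi_apply k))).aestronglyMeasurable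
        (ae_of_all _ fun x => h.norm_le _)
    have hval : ∀ j k : Fin n, ∫ x, φ (x j - x k) ∂P = if j = k then φ 0 else J := by
      intro j k
      split_ifs with hjk
      · subst hjk; simp [P]
      · have hind : ProbabilityTheory.iIndepFun (fun (i : Fin n) (x : Fin n → G) => x i) P :=
          ProbabilityTheory.iIndepFun_pi (X := fun _ => id) (fun i => aemeasurable_id)
        have h2 := (ProbabilityTheory.indepFun_iff_map_prod_eq_prod_map_map
          (measurable_pi_apply j).aemeasurable (measurable_pi_apply k).aemeasurable).1
          (hind.indepFun hjk)
        have hmp : ∀ i, P.map (fun x : Fin n → G => x i) = ν := fun i =>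
          (measurePreserving_eval (fun _ : Fin n => ν) i).map_eq
        rw [hmp, hmp] at h2
        rw [hJ, ← h2, integral_map]
        · exact ((measurable_pi_apply j).prodMk (measurable_pi_apply k)).aemeasurable
        · exact (hm.comp (measurable_fst.sub measurable_snd)).aestronglyMeasurable
    have h0 : 0 ≤ ∫ x, ∑ j, ∑ k, φ (x j - x k) ∂P := by
      apply MeasureTheory.integral_nonneg
      intro x
      simpa using h n (fun _ => 1) x
    rw [integral_finsetSum _ fun j _ => integrable_finsetSum _ fun k _ => hint j k] at h0
    simp_rw [integral_finsetSum _ fun k _ => hint _ k, hval] at h0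
    convert h0 using 1
    have : ∀ j k : Fin n, (if j = k then φ 0 else J) = J + if j = k then φ 0 - J else 0 := by
      intro j k; split_ifs <;> ring
    simp only [this, Finset.sum_add_distrib, Finset.sum_ite_eq, Finset.mem_univ, if_true,
      Finset.sum_const, Finset.card_univ, Fintype.card_fin, nsmul_eq_mul]
    ring
  have hlim : Tendsto (fun n : ℕ => ((n : ℂ) + 1)⁻¹ * φ 0 + (1 - ((n : ℂ) + 1)⁻¹) * J) atTop
      (𝓝 (0 * φ 0 + (1 - 0) * J)) := by
    have : Tendsto (fun n : ℕ => ((n : ℂ) + 1)⁻¹) atTop (𝓝 0) := by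
      simpa using tendsto_one_div_add_atTop_nhds_zero_nat (𝕜 := ℂ)
    exact (this.mul_const _).add ((tendsto_const_nhds.sub this).mul_const _)
  simp only [zero_mul, zero_add, sub_zero, one_mul] at hlim
  refine ge_of_tendsto' hlim fun n => ?_
  have h1 := key (n + 1)
  have hn : ((n : ℂ) + 1) ≠ 0 := by exact_mod_cast n.succ_ne_zero
  have h2 : (0 : ℂ) ≤ ((n : ℂ) + 1)⁻¹ * ((n : ℂ) + 1)⁻¹ := by
    have : (0 : ℂ) ≤ (((n : ℝ) + 1)⁻¹ * ((n : ℝ) + 1)⁻¹ : ℝ) := by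
      exact_mod_cast (by positivity)
    simpa using this
  convert mul_nonneg h2 h1 using 1
  push_cast
  field_simp

end PositiveDefiniteFunctions

/-! ### Bochner's theorem in finite dimension, by Gaussian regularization. -/

section BochnerTheorem

variable {E : Type*} [NormedAddCommGroup E] [InnerProductSpace ℝ E] [FiniteDimensional ℝ E]
  [MeasurableSpace E] [BorelSpace E]

theorem integrable_exp_neg_mul_norm_sq {a : ℝ} (ha : 0 < a) :
    Integrable fun t : E => Real.exp (-a * ‖t‖ ^ 2) := by
  have := (GaussianFourier.integrable_cexp_neg_mul_sq_norm_add (V := E)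
    (show 0 < (a : ℂ).re from ha) 0 0).norm
  refine this.congr (ae_of_all _ fun t => ?_)
  simp [Complex.norm_exp, ← Complex.ofReal_pow]

/-- Gaussian averages of a positive definite function are nonnegative. -/
theorem IsPosDef.integral_gaussian_nonneg {φ : E → ℂ} (h : IsPosDef φ) (hc : Continuous φ)
    {a : ℝ} (ha : 0 < a) : 0 ≤ ∫ u, (Real.exp (-a * ‖u‖ ^ 2) : ℂ) * φ u := by
  -- A product of two Gaussians of rate `b` at `u + y` and `y` is a Gaussian of rate `b / 2 = a` in
  -- `u` times one of rate `2 b` in `y + u / 2`.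
  set b := 2 * a with hb
  have hb0 : 0 < b := by positivity
  have hint := integrable_exp_neg_mul_norm_sq (E := E) hb0
  set C : ℝ := ∫ t : E, Real.exp (-b * ‖t‖ ^ 2) with hC
  have hCpos : 0 < C := by
    rw [hC, GaussianFourier.integral_rexp_neg_mul_sq_norm hb0]
    positivity
  let g : E → ℝ≥0 := fun t => (Real.exp (-b * ‖t‖ ^ 2) / C).toNNReal
  have hg : ∀ t, (g t : ℝ) = Real.exp (-b * ‖t‖ ^ 2) / C := fun t =>
    Real.coe_toNNReal _ (by positivity)
  have hgm : Measurable g := by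
    apply Measurable.real_toNNReal
    exact (by fun_prop : Continuous fun t : E => Real.exp (-b * ‖t‖ ^ 2) / C).measurable
  let ν : Measure E := volume.withDensity fun t => (g t : ℝ≥0∞)
  have hν : IsProbabilityMeasure ν := by
    constructor
    rw [withDensity_apply _ MeasurableSet.univ, Measure.restrict_univ]
    have : ∀ t, (g t : ℝ≥0∞) = ENNReal.ofReal (Real.exp (-b * ‖t‖ ^ 2) / C) := fun t => rfl
    simp_rw [this]
    rw [← ofReal_integral_eq_lintegral_ofReal (hint.div_const C)
      (ae_of_all _ fun t => by positivity), integral_div, ← hC, div_self hCpos.ne', ENNReal.ofReal_one]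
  have h1 := h.integral_nonneg hc.measurable ν
  have hbd : ∀ t, ‖φ t‖ ≤ (φ 0).re := h.norm_le
  rw [integral_prod (fun p : E × E => φ (p.1 - p.2)) (Integrable.of_bound (C := (φ 0).re)
    (hc.comp (continuous_fst.sub continuous_snd)).aestronglyMeasurable
    (ae_of_all _ fun x => hbd _))] at h1
  simp only [ν] at h1
  simp_rw [integral_withDensity_eq_integral_smul hgm, NNReal.smul_def, ← integral_smul] at h1
  have hgi : Integrable (fun t => ((g t : ℝ) : ℂ)) (volume : Measure E) := by
    simp_rw [hg]
    exact (hint.div_const C).ofReal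
  set F : E × E → ℂ := fun p => (g p.1 : ℝ) • (g p.2 : ℝ) • φ (p.1 - p.2) with hF
  have hFi : Integrable F (volume.prod volume) := by
    have h2 := (hgi.mul_prod hgi).mul_bdd (c := (φ 0).re) (g := fun p : E × E => φ (p.1 - p.2))
      (hc.comp (continuous_fst.sub continuous_snd)).aestronglyMeasurable
      (ae_of_all _ fun x => hbd _)
    refine h2.congr (ae_of_all _ fun p => ?_)
    simp only [hF, Complex.real_smul, mul_assoc]
  -- The shear makes the difference of the two points a coordinate; after completing the square, the
  -- integral over the other coordinate is a positive constant by translation invariance.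
  have hT : MeasurePreserving (fun z : E × E => (z.1 + z.2, z.2)) (volume.prod volume)
      (volume.prod volume) := measurePreserving_add_prod volume volume
  rw [← integral_prod (f := F) hFi, ← hT.map_eq, integral_map hT.measurable.aemeasurable
    (by rw [hT.map_eq]; exact hFi.aestronglyMeasurable)] at h1
  have hFT : ∀ z : E × E, F (z.1 + z.2, z.2) =
      (Real.exp (-a * ‖z.1‖ ^ 2) : ℂ) * φ z.1 *
        ((Real.exp (-(2 * b) * ‖z.2 + (1 / 2 : ℝ) • z.1‖ ^ 2) / C ^ 2 : ℝ) : ℂ) := by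
    intro z
    have e : (g (z.1 + z.2) : ℝ) * g z.2 = Real.exp (-a * ‖z.1‖ ^ 2) *
        (Real.exp (-(2 * b) * ‖z.2 + (1 / 2 : ℝ) • z.1‖ ^ 2) / C ^ 2) := by
      rw [hg, hg, div_mul_div_comm, ← Real.exp_add, mul_div_assoc', ← Real.exp_add, ← pow_two]
      congr 2
      rw [norm_add_sq_real, norm_add_sq_real, norm_smul, inner_smul_right,
        real_inner_comm z.1 z.2]
      norm_num
      ring
    simp only [hF, Complex.real_smul, add_sub_cancel_right]
    rw [← mul_assoc, ← Complex.ofReal_mul, e]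
    push_cast
    ring
  have hFTi := hT.integrable_comp_of_integrable hFi
  simp only [Function.comp_def, hFT] at h1 hFTi
  rw [integral_prod _ hFTi] at h1
  simp_rw [integral_const_mul] at h1
  have h4 : ∀ x : E, ∫ y : E, ((Real.exp (-(2 * b) * ‖y + (1 / 2 : ℝ) • x‖ ^ 2) / C ^ 2 : ℝ) : ℂ) =
      ((∫ y : E, Real.exp (-(2 * b) * ‖y‖ ^ 2) / C ^ 2 : ℝ) : ℂ) := by
    intro x
    rw [integral_add_right_eq_self (fun y : E =>
      ((Real.exp (-(2 * b) * ‖y‖ ^ 2) / C ^ 2 : ℝ) : ℂ)), integral_complex_ofReal]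
  simp_rw [h4, integral_mul_const] at h1
  have hD : 0 < ∫ y : E, Real.exp (-(2 * b) * ‖y‖ ^ 2) / C ^ 2 := by
    rw [integral_div, GaussianFourier.integral_rexp_neg_mul_sq_norm (by positivity)]
    positivity
  set D := ∫ y : E, Real.exp (-(2 * b) * ‖y‖ ^ 2) / C ^ 2
  have h5 : (0 : ℂ) ≤ ((D⁻¹ : ℝ) : ℂ) := by exact_mod_cast (inv_pos.2 hD).le
  have h6 := mul_nonneg h1 h5
  rwa [mul_assoc, ← Complex.ofReal_mul, mul_inv_cancel₀ hD.ne', Complex.ofReal_one, mul_one] at h6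

open scoped FourierTransform in
-- Self-adjointness of the Fourier transform moves it onto the Gaussian, where it becomes an
-- approximate identity at 0.
theorem tendsto_integral_gaussian_mul_fourier {f : E → ℂ} (hf : Integrable f)
    (hc : ContinuousAt f 0) :
    Tendsto (fun c : ℝ => ∫ w : E, Complex.exp (-c⁻¹ * ‖w‖ ^ 2) * 𝓕 f w) atTop (𝓝 (f 0)) := by
  refine (Real.tendsto_integral_gaussian_smul' hf hc).congr' ?_
  filter_upwards [Ioi_mem_atTop 0] with c (hc : 0 < c)
  have J : Integrable (fun w : E ↦ Complex.exp (- c⁻¹ * ‖w‖ ^ 2)) := by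
    simpa using GaussianFourier.integrable_cexp_neg_mul_sq_norm_add (V := E)
      (show 0 < ((c⁻¹ : ℝ) : ℂ).re by simpa) 0 0
  have h1 : ∫ w : E, 𝓕 (fun w : E ↦ Complex.exp (- c⁻¹ * ‖w‖ ^ 2)) w • f w =
      ∫ w : E, Complex.exp (-c⁻¹ * ‖w‖ ^ 2) * 𝓕 f w := by
    simpa using! (VectorFourier.integral_fourierIntegral_smul_eq_flip (L := innerₗ E)
      Real.continuous_fourierChar continuous_inner J hf)
  rw [← h1]
  congr with w
  rw [fourier_gaussian_innerProductSpace (by simpa)]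
  congr 2
  · simp
  · simp; ring_nf

open scoped FourierTransform in
-- The Gaussian-weighted integrals of the transform converge to `f 0`. For a nonnegative transform,
-- Fatou's lemma turns this limit into a bound on the full integral, which is what Fourier inversion
-- needs.
theorem integrable_fourier_of_nonneg {f : E → ℂ} (hf : Integrable f)
    (hc : ContinuousAt f 0) (hpos : ∀ w, 0 ≤ 𝓕 f w) : Integrable (𝓕 f) := by
  have hcont : Continuous (𝓕 f) :=
    VectorFourier.fourierIntegral_continuous (L := innerₗ E) Real.continuous_fourierChar
      continuous_inner hf
  have hbd : ∀ w, ‖𝓕 f w‖ ≤ ∫ v, ‖f v‖ := fun w =>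
    VectorFourier.norm_fourierIntegral_le_integral_norm Real.fourierChar _ (innerₗ E) f w
  have hre : ∀ w, 𝓕 f w = ((𝓕 f w).re : ℂ) := fun w =>
    Complex.ext rfl (Complex.nonneg_iff.1 (hpos w)).2.symm
  have hre0 : ∀ w, 0 ≤ (𝓕 f w).re := fun w => (Complex.nonneg_iff.1 (hpos w)).1
  have hnorm : ∀ w, ‖𝓕 f w‖ = (𝓕 f w).re := fun w => by
    rw [hre w, Complex.norm_real, Complex.ofReal_re, Real.norm_of_nonneg (hre0 w)]
  set c : ℕ → ℝ := fun n => n + 1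
  have hc0 : ∀ n, 0 < c n := fun n => by positivity
  have hclim : Tendsto c atTop atTop :=
    tendsto_atTop_add_const_right _ _ tendsto_natCast_atTop_atTop
  have h1 := (Complex.continuous_re.tendsto _).comp
    ((tendsto_integral_gaussian_mul_fourier hf hc).comp hclim)
  have hgi : ∀ n, Integrable fun w : E => Real.exp (-(c n)⁻¹ * ‖w‖ ^ 2) * ‖𝓕 f w‖ := fun n =>
    (integrable_exp_neg_mul_norm_sq (inv_pos.2 (hc0 n))).mul_bdd hcont.norm.aestronglyMeasurable
      (ae_of_all _ fun w => by rw [norm_norm]; exact hbd w)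
  have h2 : Tendsto (fun n => ∫ w : E, Real.exp (-(c n)⁻¹ * ‖w‖ ^ 2) * ‖𝓕 f w‖) atTop
      (𝓝 (f 0).re) := by
    refine h1.congr fun n => ?_
    simp only [Function.comp]
    rw [← Complex.ofReal_re (∫ w : E, Real.exp (-(c n)⁻¹ * ‖w‖ ^ 2) * ‖𝓕 f w‖),
      ← integral_complex_ofReal]
    congr 2 with w
    rw [hnorm]
    push_cast
    rw [← hre w]
  refine ⟨hcont.aestronglyMeasurable, ?_⟩
  have h3 : ∀ w : E, Tendsto (fun n => ENNReal.ofReal (Real.exp (-(c n)⁻¹ * ‖w‖ ^ 2) * ‖𝓕 f w‖))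
      atTop (𝓝 ‖𝓕 f w‖ₑ) := by
    intro w
    rw [← ofReal_norm]
    refine (ENNReal.continuous_ofReal.tendsto _).comp ?_
    have h4 := (tendsto_inv_atTop_zero.comp hclim).neg.mul_const (‖w‖ ^ 2)
    simpa using! ((Real.continuous_exp.tendsto _).comp h4).mul_const ‖𝓕 f w‖
  calc ∫⁻ w, ‖𝓕 f w‖ₑ
      = ∫⁻ w, liminf (fun n => ENNReal.ofReal (Real.exp (-(c n)⁻¹ * ‖w‖ ^ 2) * ‖𝓕 f w‖)) atTop :=
        lintegral_congr fun w => (h3 w).liminf_eq.symm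
    _ ≤ liminf (fun n => ∫⁻ w, ENNReal.ofReal (Real.exp (-(c n)⁻¹ * ‖w‖ ^ 2) * ‖𝓕 f w‖)) atTop :=
        lintegral_liminf_le fun n => (Measurable.ennreal_ofReal
          (by have := hcont.norm; exact (by fun_prop : Continuous fun w : E =>
            Real.exp (-(c n)⁻¹ * ‖w‖ ^ 2) * ‖𝓕 f w‖).measurable))
    _ = liminf (fun n => ENNReal.ofReal (∫ w, Real.exp (-(c n)⁻¹ * ‖w‖ ^ 2) * ‖𝓕 f w‖)) atTop := by
        congr with n
        rw [ofReal_integral_eq_lintegral_ofReal (hgi n) (ae_of_all _ fun w => by positivity)]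
    _ = ENNReal.ofReal (f 0).re := ((ENNReal.continuous_ofReal.tendsto _).comp h2).liminf_eq
    _ < ∞ := ENNReal.ofReal_lt_top

open scoped FourierTransform in
/-- A continuous integrable function with nonnegative Fourier transform is the characteristic
function of a finite measure, up to scaling. -/
theorem exists_measure_charFun_of_fourier_nonneg {f : E → ℂ} (hf : Integrable f)
    (hc : Continuous f) (hpos : ∀ w, 0 ≤ 𝓕 f w) :
    ∃ μ : Measure E, IsFiniteMeasure μ ∧ ∀ t, charFun μ t = f ((2 * Real.pi)⁻¹ • t) := by
  have hi := integrable_fourier_of_nonneg hf hc.continuousAt hpos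
  have hcont : Continuous (𝓕 f) :=
    VectorFourier.fourierIntegral_continuous (L := innerₗ E) Real.continuous_fourierChar
      continuous_inner hf
  have hre : ∀ w, 𝓕 f w = ((𝓕 f w).re : ℂ) := fun w =>
    Complex.ext rfl (Complex.nonneg_iff.1 (hpos w)).2.symm
  have hre0 : ∀ w, 0 ≤ (𝓕 f w).re := fun w => (Complex.nonneg_iff.1 (hpos w)).1
  refine ⟨volume.withDensity fun w => ENNReal.ofReal (𝓕 f w).re, ?_, fun t => ?_⟩
  · exact isFiniteMeasure_withDensity_ofReal hi.re.2
  · have hm : Measurable fun w => ENNReal.ofReal (𝓕 f w).re :=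
      (Complex.continuous_re.comp hcont).measurable.ennreal_ofReal
    rw [← congrFun (hc.fourierInv_fourier_eq hf hi) ((2 * Real.pi)⁻¹ • t), Real.fourierInv_eq',
      charFun_apply, integral_withDensity_eq_integral_toReal_smul hm
        (ae_of_all _ fun _ => ENNReal.ofReal_lt_top)]
    congr with w
    rw [ENNReal.toReal_ofReal (hre0 w), Complex.real_smul, smul_eq_mul, ← hre w, mul_comm,
      inner_smul_right]
    congr 3
    push_cast
    have := Real.pi_ne_zero
    field_simp

theorem integrable_gaussian_mul {φ : E → ℂ} (h : IsPosDef φ) (hc : Continuous φ) {a : ℝ}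
    (ha : 0 < a) : Integrable fun t : E => (Real.exp (-a * ‖t‖ ^ 2) : ℂ) * φ t :=
  (integrable_exp_neg_mul_norm_sq ha).ofReal.mul_bdd hc.aestronglyMeasurable
    (ae_of_all _ fun t => h.norm_le t)

open scoped FourierTransform in
-- The Gaussian factor supplies integrability. The Fourier transform of the product is a Gaussian
-- average of `φ` times a character, which is again positive definite, so it is nonnegative. The
-- rescaling by `2 π` reconciles the Fourier transform with the normalization of `charFun`.
theorem IsPosDef.exists_charFun_eq_gaussian_mul {φ : E → ℂ} (h : IsPosDef φ) (hc : Continuous φ)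
    {a : ℝ} (ha : 0 < a) :
    ∃ μ : Measure E, IsFiniteMeasure μ ∧
      ∀ t, charFun μ t = (Real.exp (-a * ‖t‖ ^ 2) : ℂ) * φ t := by
  have hpi := Real.pi_pos
  set ψ : E → ℂ := fun t => φ ((2 * Real.pi) • t)
  have hψ : IsPosDef ψ := fun n c t => by
    simpa only [ψ, smul_sub] using h n c fun j => (2 * Real.pi) • t j
  have hψc : Continuous ψ := by fun_prop
  set b : ℝ := a * (2 * Real.pi) ^ 2 with hb
  have hb0 : 0 < b := by positivity
  obtain ⟨μ, hμ, hμ'⟩ := exists_measure_charFun_of_fourier_nonneg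
    (integrable_gaussian_mul hψ hψc hb0) (by fun_prop) (fun w => by
      rw [Real.fourier_eq']
      have hχ := hψ.mul_char (-(2 * Real.pi) • w)
      refine (hχ.integral_gaussian_nonneg (by fun_prop) hb0).trans_eq
        (integral_congr_ae (ae_of_all _ fun u => ?_))
      simp only [smul_eq_mul, inner_smul_right]
      ring_nf)
  refine ⟨μ, hμ, fun t => ?_⟩
  rw [hμ' t]
  simp only [ψ, smul_smul, norm_smul]
  have e : 2 * Real.pi * (2 * Real.pi)⁻¹ = 1 := mul_inv_cancel₀ (by positivity)
  rw [e, one_smul, norm_inv, Real.norm_of_nonneg (by positivity : 0 ≤ 2 * Real.pi)]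
  have e2 : -b * ((2 * Real.pi)⁻¹ * ‖t‖) ^ 2 = -a * ‖t‖ ^ 2 := by
    rw [hb]; field_simp
  rw [e2]

/-- Let the damping rate tend to 0. The characteristic functions converge pointwise to a function
continuous at 0, so the measures are tight, and any weak limit point has characteristic function
`φ`. An ultrafilter selects the limit point in place of a subsequence. -/
theorem IsPosDef.exists_probabilityMeasure_charFun_eq {φ : E → ℂ} (h : IsPosDef φ) (hc : Continuous φ)
    (h1 : φ 0 = 1) : ∃ μ : ProbabilityMeasure E, ∀ t, charFun (μ : Measure E) t = φ t := by
  have ha : ∀ n : ℕ, (0 : ℝ) < ((n : ℝ) + 1)⁻¹ := fun n => by positivity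
  choose μ hμ hμ' using fun n => h.exists_charFun_eq_gaussian_mul hc (ha n)
  have hprob : ∀ n, IsProbabilityMeasure (μ n) := fun n => by
    have h2 := hμ' n 0
    rw [charFun_zero, h1] at h2
    have h3 : (μ n).real Set.univ = 1 := by
      simpa using h2
    exact ⟨by rw [← ENNReal.toReal_eq_one_iff]; exact h3⟩
  have hlim : ∀ t, Tendsto (fun n => charFun (μ n) t) atTop (𝓝 (φ t)) := by
    intro t
    simp_rw [hμ']
    have h2 : Tendsto (fun n : ℕ => ((n : ℝ) + 1)⁻¹) atTop (𝓝 0) := by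
      simpa using tendsto_one_div_add_atTop_nhds_zero_nat (𝕜 := ℝ)
    have h3 := ((Complex.continuous_ofReal.comp Real.continuous_exp).tendsto _).comp
      (h2.neg.mul_const (‖t‖ ^ 2))
    simpa [Function.comp_def] using h3.mul_const (φ t)
  have htight := isTightMeasureSet_of_tendsto_charFun (hc.continuousAt) hlim
  let P : ℕ → ProbabilityMeasure E := fun n => ⟨μ n, hprob n⟩
  have hcomp : IsCompact (closure (Set.range P)) := by
    refine isCompact_closure_of_isTightMeasureSet ?_
    convert htight using 1
    ext ν
    exact ⟨fun ⟨_, ⟨n, hn⟩, h⟩ => ⟨n, by rw [← h, ← hn]; rfl⟩,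
      fun ⟨n, hn⟩ => ⟨P n, ⟨n, rfl⟩, hn⟩⟩
  let U : Ultrafilter ℕ := Ultrafilter.of atTop
  have hU : (U : Filter ℕ) ≤ atTop := Ultrafilter.of_le atTop
  obtain ⟨ν, -, hν⟩ := hcomp.ultrafilter_le_nhds (U.map P)
    (by
      rw [le_principal_iff]
      exact mem_of_superset (Filter.range_mem_map) subset_closure)
  refine ⟨ν, fun t => ?_⟩
  have hν' : Tendsto P U (𝓝 ν) := hν
  rw [ProbabilityMeasure.tendsto_iff_forall_integral_rclike_tendsto ℂ] at hν'
  have h4 := hν' (BoundedContinuousFunction.innerProbChar t)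
  have h5 : Tendsto (fun n => charFun (μ n) t) U (𝓝 (charFun (ν : Measure E) t)) := by
    simp only [charFun_eq_integral_innerProbChar]
    exact h4
  exact tendsto_nhds_unique h5 ((hlim t).mono_left hU)

/-- **Bochner's theorem**. -/
theorem IsPosDef.exists_charFun_eq {φ : E → ℂ} (h : IsPosDef φ) (hc : ContinuousAt φ 0) :
    ∃ μ : Measure E, IsFiniteMeasure μ ∧ ∀ t, charFun μ t = φ t := by
  have hcont := h.continuous hc
  have h0 := (Complex.nonneg_iff.1 h.zero_nonneg).1
  rcases h0.eq_or_lt with h0 | h0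
  · refine ⟨0, inferInstance, fun t => ?_⟩
    have := h.norm_le t
    rw [← h0] at this
    rw [charFun_zero_measure, norm_le_zero_iff.1 this]
  · have hinv : (0 : ℂ) ≤ (((φ 0).re⁻¹ : ℝ) : ℂ) := by exact_mod_cast (inv_pos.2 h0).le
    have hψ : IsPosDef fun t => (((φ 0).re⁻¹ : ℝ) : ℂ) * φ t := fun n c t => by
      convert mul_nonneg hinv (h n c t) using 1
      simp_rw [Finset.mul_sum]
      refine Finset.sum_congr rfl fun j _ => Finset.sum_congr rfl fun k _ => ?_
      ring
    have hne : ((φ 0).re : ℂ) ≠ 0 := by exact_mod_cast h0.ne'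
    obtain ⟨ν, hν⟩ := hψ.exists_probabilityMeasure_charFun_eq (by fun_prop) (by
      rw [h.zero_eq]; simp [hne])
    refine ⟨(φ 0).re.toNNReal • (ν : Measure E), inferInstance, fun t => ?_⟩
    have h2 := hν t
    rw [charFun_apply] at h2 ⊢
    rw [integral_smul_nnreal_measure, h2, NNReal.smul_def, Real.coe_toNNReal _ h0.le,
      Complex.real_smul, Complex.ofReal_inv, mul_inv_cancel_left₀ hne]

end BochnerTheorem

/-! ### Approximate polar decomposition in a C*-algebra. -/

section PolarDecomposition

variable {A : Type*} [CStarAlgebra A] [PartialOrder A] [StarOrderedRing A]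

theorem norm_mul_eq_norm_abs_mul (T X : A) : ‖T * X‖ = ‖CFC.abs T * X‖ := by
  have h : ‖T * X‖ * ‖T * X‖ = ‖CFC.abs T * X‖ * ‖CFC.abs T * X‖ := by
    rw [← CStarRing.norm_star_mul_self, ← CStarRing.norm_star_mul_self, star_mul, star_mul,
      (CFC.abs_nonneg T).isSelfAdjoint.star_eq, mul_assoc, mul_assoc, ← mul_assoc (star T),
      ← CFC.abs_mul_abs, mul_assoc]
  nlinarith [norm_nonneg (T * X), norm_nonneg (CFC.abs T * X),
    mul_self_inj (norm_nonneg (T * X)) (norm_nonneg (CFC.abs T * X))]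

/-- An approximate polar decomposition: `T = V |T|` and `V* T = |T|` up to `δ`, for a
contraction `V`. -/
theorem exists_approx_polar (T : A) {δ : ℝ} (hδ : 0 < δ) :
    ∃ V : A, ‖V‖ ≤ 1 ∧ ‖V * CFC.abs T - T‖ ≤ δ ∧ ‖star V * T - CFC.abs T‖ ≤ δ := by
  set B := CFC.abs T with hB
  have hB0 : 0 ≤ B := CFC.abs_nonneg T
  have hsp : ∀ x ∈ spectrum ℝ B, 0 ≤ x := fun x hx => spectrum_nonneg_of_nonneg hB0 hx
  have hne : ∀ x ∈ spectrum ℝ B, x + δ ≠ 0 := fun x hx => by have := hsp x hx; positivity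
  -- The contraction will be `T (|T| + δ)⁻¹`. Both errors become the function `δ x / (x + δ) ≤ δ` of
  -- `|T|`, since `T` and `|T|` have equal norms after right multiplication.
  set C := cfc (fun x : ℝ => (x + δ)⁻¹) B with hC
  have hcont : ContinuousOn (fun x : ℝ => (x + δ)⁻¹) (spectrum ℝ B) :=
    ContinuousOn.inv₀ (by fun_prop) hne
  have hid : cfc (fun x : ℝ => x) B = B := cfc_id' ℝ B
  have hCs : star C = C := (cfc_predicate (R := ℝ) _ B : IsSelfAdjoint C).star_eq
  have hBC : B * C = cfc (fun x : ℝ => x * (x + δ)⁻¹) B := by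
    rw [cfc_mul (fun x : ℝ => x) _ B (by fun_prop) hcont, hid]
  have hcont2 : ContinuousOn (fun x : ℝ => x * (x + δ)⁻¹) (spectrum ℝ B) :=
    continuousOn_id.mul hcont
  have hCB : C * B = B * C := by
    rw [hBC]
    conv_lhs => rw [← hid]
    rw [hC, ← cfc_mul _ (fun x : ℝ => x) B hcont (by fun_prop)]
    simp_rw [mul_comm]
  have hBBC : B - B * (C * B) = cfc (fun x : ℝ => x - x * (x * (x + δ)⁻¹)) B := by
    rw [cfc_sub (fun x : ℝ => x) _ B (by fun_prop) (by fun_prop),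
      cfc_mul (fun x : ℝ => x) _ B (by fun_prop) hcont2, hid, hCB, hBC]
  have hn : ‖B - B * (C * B)‖ ≤ δ := by
    rw [hBBC]
    refine norm_cfc_le hδ.le fun x hx => ?_
    have h0 := hsp x hx
    have h1 : x - x * (x * (x + δ)⁻¹) = δ * (x / (x + δ)) := by field_simp [hne x hx]; ring
    rw [h1, Real.norm_of_nonneg (by positivity)]
    exact mul_le_of_le_one_right hδ.le (div_le_one_of_le₀ (by linarith) (by positivity))
  refine ⟨T * C, ?_, ?_, ?_⟩
  · rw [norm_mul_eq_norm_abs_mul, ← hB, hBC]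
    refine norm_cfc_le zero_le_one fun x hx => ?_
    have h0 := hsp x hx
    rw [Real.norm_of_nonneg (by positivity), ← div_eq_mul_inv]
    exact div_le_one_of_le₀ (by linarith) (by positivity)
  · have : T * C * B - T = T * (C * B - 1) := by rw [mul_sub, mul_one, mul_assoc]
    rw [this, norm_mul_eq_norm_abs_mul, ← hB, mul_sub, mul_one, norm_sub_rev]
    exact hn
  · rw [star_mul, hCs, mul_assoc, ← CFC.abs_mul_abs, ← hB, ← mul_assoc, hCB, mul_assoc,
      norm_sub_rev]
    exact hn

theorem exists_tendsto_polar (T : A) :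
    ∃ V : ℕ → A, (∀ n, ‖V n‖ ≤ 1) ∧ Tendsto (fun n => V n * CFC.abs T) atTop (𝓝 T) ∧
      Tendsto (fun n => star (V n) * T) atTop (𝓝 (CFC.abs T)) := by
  have hpos : ∀ n : ℕ, (0 : ℝ) < 1 / ((n : ℝ) + 1) := fun n => by positivity
  choose V h1 h2 h3 using fun n : ℕ => exists_approx_polar T (hpos n)
  exact ⟨V, h1,
    tendsto_iff_norm_sub_tendsto_zero.2 (squeeze_zero (fun _ => norm_nonneg _) h2
      tendsto_one_div_add_atTop_nhds_zero_nat),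
    tendsto_iff_norm_sub_tendsto_zero.2 (squeeze_zero (fun _ => norm_nonneg _) h3
      tendsto_one_div_add_atTop_nhds_zero_nat)⟩

end PolarDecomposition

/-! ### The trace norm: triangle inequality and comparison with the operator norm. -/

section TraceNorm

variable {V : Type*} [NormedAddCommGroup V] [InnerProductSpace ℂ V] [CompleteSpace V]
  {ι : Type*} (b : HilbertBasis ι ℂ V)

theorem traceNormAlong_eq_abs (T : V →L[ℂ] V) :
    traceNormAlong b T = ∑' j, ENNReal.ofReal (⟪CFC.abs T (b j), b j⟫_ℂ).re := rfl

/-- The Hilbert–Schmidt norm is invariant under taking adjoints. -/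
theorem tsum_norm_adjoint_sq (X : V →L[ℂ] V) :
    ∑' j, ENNReal.ofReal (‖(star X) (b j)‖ ^ 2) = ∑' j, ENNReal.ofReal (‖X (b j)‖ ^ 2) := by
  simp_rw [← tsum_ofReal_norm_inner_sq b]
  rw [ENNReal.tsum_comm]
  refine tsum_congr fun j => tsum_congr fun k => ?_
  rw [ContinuousLinearMap.star_eq_adjoint, ContinuousLinearMap.adjoint_inner_right, norm_inner_symm]

theorem nonneg_inner_eq_norm_sqrt_sq {P : V →L[ℂ] V} (hP : 0 ≤ P) (x : V) :
    ⟪P x, x⟫_ℂ = ((‖CFC.sqrt P x‖ ^ 2 : ℝ) : ℂ) := by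
  have hsym := ((ContinuousLinearMap.nonneg_iff_isPositive (CFC.sqrt P)).1
    (CFC.sqrt_nonneg _)).isSymmetric
  have h1 : P x = CFC.sqrt P (CFC.sqrt P x) :=
    congrArg (fun B : V →L[ℂ] V => B x) (CFC.sqrt_mul_sqrt_self P hP).symm
  rw [h1, show ⟪CFC.sqrt P (CFC.sqrt P x), x⟫_ℂ = ⟪CFC.sqrt P x, CFC.sqrt P x⟫_ℂ from hsym _ _,
    inner_self_eq_norm_sq_to_K]
  norm_cast

/-- With `Q = √P`, the diagonal entries are `⟪(W Q)* bⱼ, Q bⱼ⟫`. By the arithmetic-geometric mean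
inequality they are controlled by the Hilbert–Schmidt norms of `(W Q)*` and `Q`, and the former is
at most the latter. -/
theorem tsum_norm_inner_contraction_le {P W : V →L[ℂ] V} (hP : 0 ≤ P) (hW : ‖W‖ ≤ 1) :
    ∑' j, ENNReal.ofReal ‖⟪b j, (W * P) (b j)⟫_ℂ‖ ≤
      ∑' j, ENNReal.ofReal (⟪P (b j), b j⟫_ℂ).re := by
  set Q := CFC.sqrt P with hQ
  have hQs : star Q = Q := (CFC.sqrt_nonneg P).isSelfAdjoint.star_eq
  have hQQ : Q * Q = P := CFC.sqrt_mul_sqrt_self P hP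
  have hterm : ∀ j, ENNReal.ofReal ‖⟪b j, (W * P) (b j)⟫_ℂ‖ ≤
      2⁻¹ * ENNReal.ofReal (‖(star (W * Q)) (b j)‖ ^ 2) +
        2⁻¹ * ENNReal.ofReal (‖Q (b j)‖ ^ 2) := by
    intro j
    have h1 : ⟪b j, (W * P) (b j)⟫_ℂ = ⟪(star (W * Q)) (b j), Q (b j)⟫_ℂ := by
      rw [ContinuousLinearMap.star_eq_adjoint, ContinuousLinearMap.adjoint_inner_left, ← hQQ]
      rfl
    have h2 : (2⁻¹ : ℝ≥0∞) = ENNReal.ofReal 2⁻¹ := by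
      rw [ENNReal.ofReal_inv_of_pos two_pos]; simp
    rw [h1, h2, ← ENNReal.ofReal_mul (by norm_num), ← ENNReal.ofReal_mul (by norm_num),
      ← ENNReal.ofReal_add (by positivity) (by positivity)]
    refine ENNReal.ofReal_le_ofReal ((norm_inner_le_norm _ _).trans ?_)
    nlinarith [sq_nonneg (‖(star (W * Q)) (b j)‖ - ‖Q (b j)‖)]
  have hP' : ∑' j, ENNReal.ofReal (⟪P (b j), b j⟫_ℂ).re =
      ∑' j, ENNReal.ofReal (‖Q (b j)‖ ^ 2) := by
    refine tsum_congr fun j => ?_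
    rw [nonneg_inner_eq_norm_sqrt_sq hP, Complex.ofReal_re]
  have hWQ : ∑' j, ENNReal.ofReal (‖(star (W * Q)) (b j)‖ ^ 2) ≤
      ∑' j, ENNReal.ofReal (‖Q (b j)‖ ^ 2) := by
    rw [tsum_norm_adjoint_sq]
    refine ENNReal.tsum_le_tsum fun j => ENNReal.ofReal_le_ofReal ?_
    have : ‖(W * Q) (b j)‖ ≤ ‖Q (b j)‖ := by
      refine (W.le_opNorm (Q (b j))).trans ?_
      exact mul_le_of_le_one_left (norm_nonneg _) hW
    gcongr
  calc _ ≤ ∑' j, (2⁻¹ * ENNReal.ofReal (‖(star (W * Q)) (b j)‖ ^ 2) +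
        2⁻¹ * ENNReal.ofReal (‖Q (b j)‖ ^ 2)) := ENNReal.tsum_le_tsum hterm
    _ = 2⁻¹ * ∑' j, ENNReal.ofReal (‖(star (W * Q)) (b j)‖ ^ 2) +
        2⁻¹ * ∑' j, ENNReal.ofReal (‖Q (b j)‖ ^ 2) := by
      rw [ENNReal.tsum_add, ENNReal.tsum_mul_left, ENNReal.tsum_mul_left]
    _ ≤ 2⁻¹ * ∑' j, ENNReal.ofReal (‖Q (b j)‖ ^ 2) +
        2⁻¹ * ∑' j, ENNReal.ofReal (‖Q (b j)‖ ^ 2) := by gcongr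
    _ = _ := by rw [← add_mul, ENNReal.inv_two_add_inv_two, one_mul, hP']

/-- Approximate `T` by `Uₙ |T|` and absorb `Uₙ` into the contraction. The sum is finite so that it
is continuous for the operator norm. -/
theorem sum_norm_inner_contraction_le (T : V →L[ℂ] V) {W : V →L[ℂ] V} (hW : ‖W‖ ≤ 1)
    (s : Finset ι) :
    ∑ j ∈ s, ENNReal.ofReal ‖⟪b j, (W * T) (b j)⟫_ℂ‖ ≤ traceNorm T := by
  obtain ⟨U, hU, hlim, -⟩ := exists_tendsto_polar T
  have hcont : Continuous fun X : V →L[ℂ] V =>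
      ∑ j ∈ s, ENNReal.ofReal ‖⟪b j, (W * X) (b j)⟫_ℂ‖ := by
    refine continuous_finsetSum _ fun j _ => ENNReal.continuous_ofReal.comp ?_
    have : Continuous fun X : V →L[ℂ] V => W (X (b j)) := by fun_prop
    exact (continuous_const.inner this).norm
  refine le_of_tendsto' ((hcont.tendsto T).comp hlim) fun n => ?_
  rw [traceNorm_eq b, traceNormAlong_eq_abs]
  refine le_trans ?_ (tsum_norm_inner_contraction_le b (W := W * U n) (CFC.abs_nonneg T)
    ((norm_mul_le _ _).trans (mul_le_one₀ hW (norm_nonneg _) (hU n))))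
  simp only [Function.comp, ← mul_assoc]
  exact ENNReal.sum_le_tsum s

/-- The triangle inequality for the trace norm. -/
theorem traceNorm_add_le (S T : V →L[ℂ] V) : traceNorm (S + T) ≤ traceNorm S + traceNorm T := by
  set b := onb V
  rw [traceNorm_eq b (S + T), traceNormAlong_eq_abs, ENNReal.tsum_eq_iSup_sum]
  refine iSup_le fun s => ?_
  -- Since `Uₙ* (S + T)` tends to `|S + T|`, a finite partial trace of `|S + T|` splits additively
  -- up to a limit.
  obtain ⟨U, hU, -, hlim⟩ := exists_tendsto_polar (S + T)
  have hcont : Continuous fun X : V →L[ℂ] V => ∑ j ∈ s, ENNReal.ofReal (⟪X (b j), b j⟫_ℂ).re := by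
    refine continuous_finsetSum _ fun j _ => ENNReal.continuous_ofReal.comp
      (Complex.continuous_re.comp ?_)
    have : Continuous fun X : V →L[ℂ] V => X (b j) := by fun_prop
    exact this.inner continuous_const
  refine le_of_tendsto' ((hcont.tendsto _).comp hlim) fun n => ?_
  have hU' : ‖star (U n)‖ ≤ 1 := by rw [norm_star]; exact hU n
  refine le_trans ?_ (add_le_add (sum_norm_inner_contraction_le b S hU' s)
    (sum_norm_inner_contraction_le b T hU' s))
  rw [← Finset.sum_add_distrib]
  refine Finset.sum_le_sum fun j _ => ?_
  rw [← ENNReal.ofReal_add (norm_nonneg _) (norm_nonneg _)]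
  refine ENNReal.ofReal_le_ofReal ((Complex.re_le_norm _).trans ?_)
  rw [norm_inner_symm]
  simp only [mul_add]
  rw [add_apply, inner_add_right]
  exact norm_add_le _ _

theorem traceNorm_smul_of_norm_eq_one {c : ℂ} (hc : ‖c‖ = 1) (T : V →L[ℂ] V) :
    traceNorm (c • T) = traceNorm T := by
  have h : star (c • T) * (c • T) = star T * T := by
    rw [star_smul, smul_mul_smul_comm, Complex.star_def, ← Complex.normSq_eq_conj_mul_self,
      Complex.normSq_eq_norm_sq, hc]
    simp
  rw [traceNorm, traceNorm, traceNormAlong, traceNormAlong, h]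

theorem traceNorm_neg (T : V →L[ℂ] V) : traceNorm (-T) = traceNorm T := by
  rw [← traceNorm_smul_of_norm_eq_one (c := -1) (by simp) T, neg_one_smul]

theorem traceNorm_sub_comm (S T : V →L[ℂ] V) : traceNorm (S - T) = traceNorm (T - S) := by
  rw [← traceNorm_neg, neg_sub]

theorem IsTraceClass.add {S T : V →L[ℂ] V} (hS : IsTraceClass S) (hT : IsTraceClass T) :
    IsTraceClass (S + T) :=
  (traceNorm_add_le S T).trans_lt (ENNReal.add_lt_top.2 ⟨hS, hT⟩)

theorem IsTraceClass.sub {S T : V →L[ℂ] V} (hS : IsTraceClass S) (hT : IsTraceClass T) :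
    IsTraceClass (S - T) := by
  rw [sub_eq_add_neg]
  exact hS.add ((traceNorm_neg T).trans_lt hT)

theorem traceNorm_of_isPositive {T : V →L[ℂ] V} (hT : T.IsPositive) :
    traceNorm T = ∑' j, ENNReal.ofReal (⟪b j, T (b j)⟫_ℂ).re := by
  have hT0 := (ContinuousLinearMap.nonneg_iff_isPositive T).2 hT
  rw [traceNorm_eq b, traceNormAlong_eq_abs, CFC.abs_of_nonneg T hT0]
  refine tsum_congr fun j => ?_
  rw [← inner_conj_symm, Complex.conj_re]

/-- For `Q = √|T|`, Parseval and Cauchy–Schwarz bound `‖Q‖²` by the squared Hilbert–Schmidt norm of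
`Q`, which is the trace norm of `T`; and `‖T‖ = ‖Q‖²`. -/
theorem ofReal_norm_le_traceNorm (T : V →L[ℂ] V) : ENNReal.ofReal ‖T‖ ≤ traceNorm T := by
  by_cases htop : traceNorm T = ∞
  · simp [htop]
  set P := CFC.abs T
  have hP : 0 ≤ P := CFC.abs_nonneg T
  set Q := CFC.sqrt P
  have hQs : star Q = Q := (CFC.sqrt_nonneg P).isSelfAdjoint.star_eq
  have hTr : traceNorm T = ∑' j, ENNReal.ofReal (‖Q (onb V j)‖ ^ 2) := by
    rw [traceNorm_eq (onb V), traceNormAlong_eq_abs]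
    refine tsum_congr fun j => ?_
    rw [nonneg_inner_eq_norm_sqrt_sq hP, Complex.ofReal_re]
  have hQ : ‖Q‖ ≤ Real.sqrt (traceNorm T).toReal := by
    refine Q.opNorm_le_bound (Real.sqrt_nonneg _) fun x => ?_
    have h1 : ENNReal.ofReal (‖Q x‖ ^ 2) ≤ ENNReal.ofReal ((traceNorm T).toReal * ‖x‖ ^ 2) := by
      rw [← tsum_ofReal_norm_inner_sq (onb V), ENNReal.ofReal_mul ENNReal.toReal_nonneg,
        ENNReal.ofReal_toReal htop, hTr, ← ENNReal.tsum_mul_right]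
      refine ENNReal.tsum_le_tsum fun j => ?_
      rw [← ENNReal.ofReal_mul (by positivity)]
      refine ENNReal.ofReal_le_ofReal ?_
      rw [← mul_pow]
      have h2 : ⟪onb V j, Q x⟫_ℂ = ⟪Q (onb V j), x⟫_ℂ := by
        conv_rhs => rw [← hQs]
        rw [ContinuousLinearMap.star_eq_adjoint, ContinuousLinearMap.adjoint_inner_left]
      rw [h2]
      gcongr
      exact norm_inner_le_norm _ _
    have h3 := (ENNReal.ofReal_le_ofReal_iff (by positivity)).1 h1
    rw [← Real.sqrt_sq (norm_nonneg x), ← Real.sqrt_mul ENNReal.toReal_nonneg]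
    exact Real.le_sqrt_of_sq_le h3
  have hPQ : P = star Q * Q := by
    rw [hQs]; exact (CFC.sqrt_mul_sqrt_self P hP).symm
  have hTn : ‖T‖ ≤ (traceNorm T).toReal := by
    rw [← CFC.norm_abs (a := T), show CFC.abs T = P from rfl, hPQ, CStarRing.norm_star_mul_self,
      ← Real.mul_self_sqrt (ENNReal.toReal_nonneg (a := traceNorm T))]
    gcongr
  exact (ENNReal.ofReal_le_ofReal hTn).trans ENNReal.ofReal_toReal_le

theorem tendsto_of_tendsto_traceNorm {α : Type*} {l : Filter α} {F : α → V →L[ℂ] V}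
    {T : V →L[ℂ] V} (h : Tendsto (fun n => traceNorm (F n - T)) l (𝓝 0)) :
    Tendsto F l (𝓝 T) := by
  rw [tendsto_iff_norm_sub_tendsto_zero]
  have h1 : Tendsto (fun n => ENNReal.ofReal ‖F n - T‖) l (𝓝 0) :=
    tendsto_of_tendsto_of_tendsto_of_le_of_le tendsto_const_nhds h (fun _ => zero_le)
      fun n => ofReal_norm_le_traceNorm _
  have h2 := (ENNReal.tendsto_toReal ENNReal.zero_ne_top).comp h1
  simpa [Function.comp_def, ENNReal.toReal_ofReal (norm_nonneg _)] using h2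

end TraceNorm

/-! ### Functions on `V` that are quadratic forms of bounded operators. -/

section Forms

variable {V : Type*} [NormedAddCommGroup V] [InnerProductSpace ℂ V]

/-- A function `q` on `V` satisfies every linear identity which holds for all the quadratic forms
`v ↦ ⟨v, T v⟩` of bounded operators. -/
def IsOperatorForm (q : V → ℂ) : Prop :=
  ∀ L : V →₀ ℂ, (∀ T : V →L[ℂ] V, Finsupp.linearCombination ℂ (fun v => ⟪v, T v⟫_ℂ) L = 0) →
    Finsupp.linearCombination ℂ q L = 0

/-- The polarization of a function on `V`. -/
def polarize (q : V → ℂ) (x y : V) : ℂ :=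
  (q (x + y) - q (x - y) - Complex.I * q (x + Complex.I • y) +
    Complex.I * q (x - Complex.I • y)) / 4

/-- The formal linear combination of vectors that computes the polarization. -/
def polarizer (x y : V) : V →₀ ℂ :=
  (4⁻¹ : ℂ) • (Finsupp.single (x + y) 1 - Finsupp.single (x - y) 1 -
    Finsupp.single (x + Complex.I • y) Complex.I + Finsupp.single (x - Complex.I • y) Complex.I)

theorem linearCombination_polarizer (q : V → ℂ) (x y : V) :
    Finsupp.linearCombination ℂ q (polarizer x y) = polarize q x y := by
  simp only [polarizer, polarize, map_smul, map_sub, map_add, Finsupp.linearCombination_single,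
    smul_eq_mul, one_mul]
  ring

/-- The four evaluation points have norm at most 2, so each value is at most `4 |C|`; the
polarization divides their sum by 4. -/
theorem norm_polarize_le {q : V → ℂ} {C : ℝ} (hC : ∀ v, ‖q v‖ ≤ C * ‖v‖ ^ 2) {x y : V}
    (hx : ‖x‖ ≤ 1) (hy : ‖y‖ ≤ 1) : ‖polarize q x y‖ ≤ 4 * |C| := by
  have hb : ∀ v : V, ‖v‖ ≤ 2 → ‖q v‖ ≤ 4 * |C| := fun v hv => by
    have h1 := hC v
    have h2 : C * ‖v‖ ^ 2 ≤ |C| * 2 ^ 2 := by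
      gcongr
      exact le_abs_self C
    linarith
  have hIy : ‖Complex.I • y‖ ≤ 1 := by rwa [norm_smul, Complex.norm_I, one_mul]
  have h1 := hb (x + y) ((norm_add_le _ _).trans (by linarith))
  have h2 := hb (x - y) ((norm_sub_le _ _).trans (by linarith))
  have h3 := hb (x + Complex.I • y) ((norm_add_le _ _).trans (by linarith))
  have h4 := hb (x - Complex.I • y) ((norm_sub_le _ _).trans (by linarith))
  rw [polarize, norm_div, show ‖(4 : ℂ)‖ = 4 by simp, div_le_iff₀ (by norm_num)]
  refine (norm_add_le _ _).trans ?_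
  have e1 := norm_sub_le (q (x + y) - q (x - y)) (Complex.I * q (x + Complex.I • y))
  have e2 := norm_sub_le (q (x + y)) (q (x - y))
  rw [norm_mul, Complex.norm_I, one_mul] at e1 ⊢
  linarith

variable [CompleteSpace V]

theorem polarize_inner (T : V →L[ℂ] V) (x y : V) :
    polarize (fun v => ⟪v, T v⟫_ℂ) x y = ⟪x, T y⟫_ℂ := by
  have h := inner_map_polarization' (ContinuousLinearMap.adjoint T : V →L[ℂ] V).toLinearMap x y
  simp only [ContinuousLinearMap.coe_coe, ContinuousLinearMap.adjoint_inner_left] at h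
  rw [h, polarize]

/-- Here and in the next four lemmas the law is encoded as a formal combination of vectors that
every operator form annihilates, because the polarization of such a form is `⟪x, T y⟫`. -/
theorem IsOperatorForm.polarize_self {q : V → ℂ} (hq : IsOperatorForm q) (x : V) :
    polarize q x x = q x := by
  have h := hq (polarizer x x - Finsupp.single x 1) (fun T => by
    rw [map_sub, linearCombination_polarizer, polarize_inner]; simp)
  rw [map_sub, linearCombination_polarizer] at h
  simpa [sub_eq_zero] using h

theorem IsOperatorForm.polarize_add_left {q : V → ℂ} (hq : IsOperatorForm q) (x x' y : V) :
    polarize q (x + x') y = polarize q x y + polarize q x' y := by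
  have h := hq (polarizer (x + x') y - (polarizer x y + polarizer x' y)) (fun T => by
    simp only [map_sub, map_add, linearCombination_polarizer, polarize_inner, inner_add_left,
      sub_self])
  simpa only [map_sub, map_add, linearCombination_polarizer, sub_eq_zero] using h

theorem IsOperatorForm.polarize_add_right {q : V → ℂ} (hq : IsOperatorForm q) (x y y' : V) :
    polarize q x (y + y') = polarize q x y + polarize q x y' := by
  have h := hq (polarizer x (y + y') - (polarizer x y + polarizer x y')) (fun T => by
    simp only [map_sub, map_add, linearCombination_polarizer, polarize_inner, inner_add_right,
      sub_self])
  simpa only [map_sub, map_add, linearCombination_polarizer, sub_eq_zero] using h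

theorem IsOperatorForm.polarize_smul_left {q : V → ℂ} (hq : IsOperatorForm q) (c : ℂ) (x y : V) :
    polarize q (c • x) y = starRingEnd ℂ c • polarize q x y := by
  have h := hq (polarizer (c • x) y - starRingEnd ℂ c • polarizer x y) (fun T => by
    simp only [map_sub, map_smul, linearCombination_polarizer, polarize_inner, inner_smul_left,
      smul_eq_mul, sub_self])
  simpa only [map_sub, map_smul, linearCombination_polarizer, sub_eq_zero] using h

theorem IsOperatorForm.polarize_smul_right {q : V → ℂ} (hq : IsOperatorForm q) (c : ℂ) (x y : V) :
    polarize q x (c • y) = c • polarize q x y := by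
  have h := hq (polarizer x (c • y) - c • polarizer x y) (fun T => by
    simp only [map_sub, map_smul, linearCombination_polarizer, polarize_inner, inner_smul_right,
      smul_eq_mul, sub_self])
  simpa only [map_sub, map_smul, linearCombination_polarizer, sub_eq_zero] using h

theorem IsOperatorForm.norm_polarize_le {q : V → ℂ} (hq : IsOperatorForm q) {C : ℝ}
    (hC : ∀ v, ‖q v‖ ≤ C * ‖v‖ ^ 2) (x y : V) : ‖polarize q x y‖ ≤ 4 * |C| * ‖x‖ * ‖y‖ := by
  have hunit : ∀ x : V, ∃ u : V, ‖u‖ ≤ 1 ∧ x = (‖x‖ : ℂ) • u := fun x => by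
    by_cases hx : x = 0
    · exact ⟨0, by simp, by simp [hx]⟩
    · have hx' : (‖x‖ : ℂ) ≠ 0 := by simpa using hx
      refine ⟨(‖x‖ : ℂ)⁻¹ • x, ?_, by rw [smul_inv_smul₀ hx']⟩
      rw [norm_smul, norm_inv, Complex.norm_real, norm_norm, inv_mul_cancel₀ (norm_ne_zero_iff.2 hx)]
  obtain ⟨u, hu, hxu⟩ := hunit x
  obtain ⟨w, hw, hyw⟩ := hunit y
  have e : polarize q x y = (‖x‖ : ℂ) * ((‖y‖ : ℂ) * polarize q u w) := by
    conv_lhs => rw [hxu, hyw]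
    rw [hq.polarize_smul_left, hq.polarize_smul_right, Complex.conj_ofReal, smul_eq_mul,
      smul_eq_mul]
  rw [e, norm_mul, norm_mul, Complex.norm_real, Complex.norm_real, norm_norm, norm_norm]
  have := OperatorBochner.norm_polarize_le hC hu hw
  calc _ ≤ ‖x‖ * (‖y‖ * (4 * |C|)) := by gcongr
    _ = _ := by ring

/-- A bounded quadratic form that satisfies the linear identities of operator forms comes from a
bounded operator. -/
theorem IsOperatorForm.exists_operator {q : V → ℂ} (hq : IsOperatorForm q) {C : ℝ}
    (hC : ∀ v, ‖q v‖ ≤ C * ‖v‖ ^ 2) : ∃ T : V →L[ℂ] V, ∀ v, ⟪v, T v⟫_ℂ = q v := by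
  let B : V →ₗ⋆[ℂ] V →ₗ[ℂ] ℂ := LinearMap.mk₂'ₛₗ (starRingEnd ℂ) (RingHom.id ℂ) (polarize q)
    hq.polarize_add_left hq.polarize_smul_left hq.polarize_add_right hq.polarize_smul_right
  let B' : V →L⋆[ℂ] V →L[ℂ] ℂ := B.mkContinuous₂ (4 * |C|) (hq.norm_polarize_le hC)
  -- The Riesz operator of `B'` sits in the first slot of the inner product; the adjoint moves it to
  -- the second.
  refine ⟨ContinuousLinearMap.adjoint (InnerProductSpace.continuousLinearMapOfBilin B'),
    fun v => ?_⟩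
  rw [ContinuousLinearMap.adjoint_inner_right,
    InnerProductSpace.continuousLinearMapOfBilin_apply]
  exact hq.polarize_self v

end Forms

/-! ### Linear relations between finite measures. -/

section MeasureCombination

variable {ι α : Type*} [MeasurableSpace α]

/-- The combination of measures with the positive parts of real coefficients. -/
def posCombination (s : Finset ι) (r : ι → ℝ) (m : ι → Measure α) : Measure α :=
  ∑ i ∈ s, (r i).toNNReal • m i

instance (s : Finset ι) (r : ι → ℝ) (m : ι → Measure α) [∀ i, IsFiniteMeasure (m i)] :
    IsFiniteMeasure (posCombination s r m) := by
  unfold posCombination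
  infer_instance

theorem integral_posCombination {F : Type*} [NormedAddCommGroup F] [NormedSpace ℝ F]
    (s : Finset ι) (r : ι → ℝ) (m : ι → Measure α) {f : α → F} (hf : ∀ i ∈ s, Integrable f (m i)) :
    ∫ x, f x ∂(posCombination s r m) = ∑ i ∈ s, (max (r i) 0) • ∫ x, f x ∂(m i) := by
  rw [posCombination, integral_finsetSum_measure fun i hi => (hf i hi).smul_measure_nnreal]
  refine Finset.sum_congr rfl fun i _ => ?_
  rw [integral_smul_nnreal_measure, NNReal.smul_def, Real.coe_toNNReal']

theorem integral_posCombination_sub {F : Type*} [NormedAddCommGroup F] [NormedSpace ℝ F]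
    (s : Finset ι) (r : ι → ℝ) (m : ι → Measure α) {f : α → F} (hf : ∀ i ∈ s, Integrable f (m i)) :
    ∫ x, f x ∂(posCombination s r m) - ∫ x, f x ∂(posCombination s (-r) m) =
      ∑ i ∈ s, r i • ∫ x, f x ∂(m i) := by
  rw [integral_posCombination s r m hf, integral_posCombination s (-r) m hf,
    ← Finset.sum_sub_distrib]
  refine Finset.sum_congr rfl fun i _ => ?_
  rw [← sub_smul, Pi.neg_apply, max_zero_sub_max_neg_zero_eq_self]

/-- Separating positive from negative coefficients turns the relation into an equality of two
positive measures, whose integrals agree. -/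
theorem sum_integral_eq_zero_of_sum_measureReal {m : ι → Measure α} [∀ i, IsFiniteMeasure (m i)]
    {s : Finset ι} {r : ι → ℝ} (h : ∀ A, MeasurableSet A → ∑ i ∈ s, r i * (m i).real A = 0)
    {F : Type*} [NormedAddCommGroup F] [NormedSpace ℝ F] {f : α → F}
    (hf : ∀ i ∈ s, Integrable f (m i)) : ∑ i ∈ s, r i • ∫ x, f x ∂(m i) = 0 := by
  have heq : posCombination s r m = posCombination s (-r) m := by
    ext A hA
    rw [← measureReal_eq_measureReal_iff, ← sub_eq_zero, ← integral_indicator_one hA,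
      ← integral_indicator_one hA, integral_posCombination_sub]
    · simpa [integral_indicator_one hA] using h A hA
    · exact fun i _ => (integrable_const (1 : ℝ)).indicator hA
  rw [← integral_posCombination_sub s r m hf, heq, sub_self]

theorem sum_measureReal_eq_zero_of_sum_charFun {E : Type*} [NormedAddCommGroup E]
    [InnerProductSpace ℝ E] [FiniteDimensional ℝ E] [MeasurableSpace E] [BorelSpace E]
    {m : ι → Measure E} [∀ i, IsFiniteMeasure (m i)] {s : Finset ι} {r : ι → ℝ}
    (h : ∀ t, ∑ i ∈ s, (r i : ℂ) * charFun (m i) t = 0) {A : Set E} (hA : MeasurableSet A) :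
    ∑ i ∈ s, r i * (m i).real A = 0 := by
  have heq : posCombination s r m = posCombination s (-r) m := by
    have := FiniteDimensional.complete ℝ E
    refine Measure.ext_of_charFun (funext fun t => ?_)
    rw [← sub_eq_zero, charFun_eq_integral_innerProbChar, charFun_eq_integral_innerProbChar,
      integral_posCombination_sub]
    · simpa only [charFun_eq_integral_innerProbChar, Complex.real_smul] using h t
    · exact fun i _ => BoundedContinuousFunction.integrable _ _
  have h1 := integral_posCombination_sub s r m (f := A.indicator (1 : E → ℝ))
    fun i _ => (integrable_const (1 : ℝ)).indicator hA
  rw [heq, sub_self] at h1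
  simpa [integral_indicator_one hA] using h1.symm

end MeasureCombination

/-! ### Operator forms arising from families of measures. -/

section FormsOfMeasures

variable {V : Type*} [NormedAddCommGroup V] [InnerProductSpace ℂ V]

theorem isOperatorForm_integral {α : Type*} [MeasurableSpace α] {m : V → Measure α}
    [∀ v, IsFiniteMeasure (m v)]
    (hm : ∀ A, MeasurableSet A → IsOperatorForm fun v => ((m v).real A : ℂ))
    {f : α → ℝ} (hf : ∀ v, Integrable f (m v)) :
    IsOperatorForm fun v => ((∫ x, f x ∂(m v) : ℝ) : ℂ) := by
  intro L hL
  have hA : ∀ A, MeasurableSet A → ∑ v ∈ L.support, L v * ((m v).real A : ℂ) = 0 := fun A hA => by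
    simpa [Finsupp.linearCombination_apply, Finsupp.sum] using hm A hA L hL
  have hre : ∑ v ∈ L.support, (L v).re • ∫ x, f x ∂(m v) = 0 :=
    sum_integral_eq_zero_of_sum_measureReal (fun A h => by
      simpa [Complex.re_sum] using congrArg Complex.re (hA A h)) fun v _ => hf v
  have him : ∑ v ∈ L.support, (L v).im • ∫ x, f x ∂(m v) = 0 :=
    sum_integral_eq_zero_of_sum_measureReal (fun A h => by
      simpa [Complex.im_sum] using congrArg Complex.im (hA A h)) fun v _ => hf v
  rw [Finsupp.linearCombination_apply, Finsupp.sum]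
  apply Complex.ext
  · simpa [Complex.re_sum] using hre
  · simpa [Complex.im_sum] using him

/-- Uniqueness for characteristic functions is available for real coefficients. Conjugating the
relation at `-t` shows that it also holds with conjugated coefficients, so the real and imaginary
parts of the coefficients satisfy it separately. -/
theorem isOperatorForm_measureReal_of_charFun {E : Type*} [NormedAddCommGroup E]
    [InnerProductSpace ℝ E] [FiniteDimensional ℝ E] [MeasurableSpace E] [BorelSpace E]
    {m : V → Measure E} [∀ v, IsFiniteMeasure (m v)] {K : E → V →L[ℂ] V}
    (hK : ∀ v t, charFun (m v) t = ⟪v, K t v⟫_ℂ) {A : Set E} (hA : MeasurableSet A) :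
    IsOperatorForm fun v => ((m v).real A : ℂ) := by
  intro L hL
  have h1 : ∀ t, ∑ v ∈ L.support, L v * charFun (m v) t = 0 := fun t => by
    simpa [Finsupp.linearCombination_apply, Finsupp.sum, hK] using hL (K t)
  have h2 : ∀ t, ∑ v ∈ L.support, starRingEnd ℂ (L v) * charFun (m v) t = 0 := fun t => by
    have := congrArg (starRingEnd ℂ) (h1 (-t))
    simpa [map_sum, charFun_neg] using this
  have hre : ∑ v ∈ L.support, (L v).re * (m v).real A = 0 :=
    sum_measureReal_eq_zero_of_sum_charFun (fun t => by
      have := congrArg₂ (· + ·) (h1 t) (h2 t)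
      rw [← Finset.sum_add_distrib] at this
      simp_rw [← add_mul, Complex.add_conj] at this
      push_cast at this
      simp_rw [mul_assoc, ← Finset.mul_sum] at this
      simpa using this) hA
  have him : ∑ v ∈ L.support, (L v).im * (m v).real A = 0 :=
    sum_measureReal_eq_zero_of_sum_charFun (fun t => by
      have := congrArg₂ (· - ·) (h1 t) (h2 t)
      rw [← Finset.sum_sub_distrib] at this
      simp_rw [← sub_mul, Complex.sub_conj] at this
      push_cast at this
      simp_rw [mul_assoc, mul_left_comm _ Complex.I, ← Finset.mul_sum] at this
      simpa using this) hA
  rw [Finsupp.linearCombination_apply, Finsupp.sum]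
  apply Complex.ext
  · simpa [Complex.re_sum] using hre
  · simpa [Complex.im_sum] using him

end FormsOfMeasures

/-! ### Operators and positivity in terms of quadratic forms. -/

section PositiveOperators

variable {V : Type*} [NormedAddCommGroup V] [InnerProductSpace ℂ V]

theorem tendsto_inner_apply {α : Type*} {l : Filter α} {F : α → V →L[ℂ] V} {T : V →L[ℂ] V}
    (h : Tendsto F l (𝓝 T)) (v w : V) : Tendsto (fun n => ⟪v, F n w⟫_ℂ) l (𝓝 ⟪v, T w⟫_ℂ) := by
  have : Continuous fun X : V →L[ℂ] V => ⟪v, X w⟫_ℂ :=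
    continuous_const.inner (by fun_prop : Continuous fun X : V →L[ℂ] V => X w)
  exact (this.tendsto T).comp h

theorem ext_inner_self {S T : V →L[ℂ] V} (h : ∀ v, ⟪v, S v⟫_ℂ = ⟪v, T v⟫_ℂ) : S = T := by
  have : (S : V →L[ℂ] V).toLinearMap = T.toLinearMap := by
    refine (ext_inner_map _ _).1 fun v => ?_
    have := congrArg (starRingEnd ℂ) (h v)
    rw [inner_conj_symm, inner_conj_symm] at this
    exact this
  exact ContinuousLinearMap.coe_injective this

theorem isPositive_iff_inner_nonneg {T : V →L[ℂ] V} :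
    T.IsPositive ↔ ∀ v, 0 ≤ ⟪v, T v⟫_ℂ := by
  rw [ContinuousLinearMap.isPositive_iff_complex]
  refine forall_congr' fun v => ?_
  rw [← inner_conj_symm v (T v), Complex.nonneg_iff, Complex.conj_re, Complex.conj_im]
  constructor
  · rintro ⟨h1, h2⟩
    refine ⟨h2, ?_⟩
    rw [← h1]; simp
  · rintro ⟨h1, h2⟩
    exact ⟨Complex.ext rfl (by simp at h2 ⊢; exact h2.symm), h1⟩

theorem inner_eq_re_of_isPositive {T : V →L[ℂ] V} (hT : T.IsPositive) (v : V) :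
    ⟪v, T v⟫_ℂ = ((⟪v, T v⟫_ℂ).re : ℂ) :=
  Complex.ext rfl (Complex.nonneg_iff.1 (isPositive_iff_inner_nonneg.1 hT v)).2.symm

theorem re_inner_nonneg_of_isPositive {T : V →L[ℂ] V} (hT : T.IsPositive) (v : V) :
    0 ≤ (⟪v, T v⟫_ℂ).re :=
  (Complex.nonneg_iff.1 (isPositive_iff_inner_nonneg.1 hT v)).1

end PositiveOperators

/-! ### Scalar measures attached to an operator-valued measure. -/

section ScalarMeasure

variable {α : Type*} [MeasurableSpace α] {V : Type*} [NormedAddCommGroup V]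
  [InnerProductSpace ℂ V] [CompleteSpace V] (μ : PosTraceClassMeasure α V)

theorem PosTraceClassMeasure.empty : μ.toFun ∅ = 0 := by
  have h := tendsto_of_tendsto_traceNorm (μ.iUnion (fun _ => ∅) (fun _ => MeasurableSet.empty)
    (fun _ _ _ => disjoint_bot_left))
  simp only [Set.iUnion_empty] at h
  have h1 := ((tendsto_add_atTop_iff_nat 1).2 h).sub h
  simp only [Finset.sum_range_succ, add_sub_cancel_left, sub_self] at h1
  exact tendsto_nhds_unique tendsto_const_nhds h1

/-- The scalar measure `A ↦ ⟨v, μ(A) v⟩`. -/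
def PosTraceClassMeasure.scalar (v : V) : Measure α :=
  Measure.ofMeasurable (fun A _ => ENNReal.ofReal (⟪v, μ.toFun A v⟫_ℂ).re)
    (by simp [μ.empty])
    (by
      intro A hA hd
      have h := tendsto_of_tendsto_traceNorm (μ.iUnion A hA fun i j hij => hd hij)
      have h1 := (Complex.continuous_re.tendsto _).comp (tendsto_inner_apply h v v)
      have h2 : HasSum (fun i => (⟪v, μ.toFun (A i) v⟫_ℂ).re) (⟪v, μ.toFun (⋃ i, A i) v⟫_ℂ).re := by
        rw [hasSum_iff_tendsto_nat_of_nonneg fun i =>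
          re_inner_nonneg_of_isPositive (μ.isPositive _ (hA i)) v]
        refine h1.congr fun n => ?_
        simp [Complex.re_sum]
      rw [← h2.tsum_eq, ENNReal.ofReal_tsum_of_nonneg (fun i =>
        re_inner_nonneg_of_isPositive (μ.isPositive _ (hA i)) v) h2.summable])

theorem PosTraceClassMeasure.scalar_apply (v : V) {A : Set α} (hA : MeasurableSet A) :
    μ.scalar v A = ENNReal.ofReal (⟪v, μ.toFun A v⟫_ℂ).re :=
  Measure.ofMeasurable_apply A hA

instance (v : V) : IsFiniteMeasure (μ.scalar v) :=
  ⟨by rw [μ.scalar_apply v MeasurableSet.univ]; exact ENNReal.ofReal_lt_top⟩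

theorem PosTraceClassMeasure.scalar_real (v : V) {A : Set α} (hA : MeasurableSet A) :
    ((μ.scalar v).real A : ℂ) = ⟪v, μ.toFun A v⟫_ℂ := by
  rw [Measure.real, μ.scalar_apply v hA,
    ENNReal.toReal_ofReal (re_inner_nonneg_of_isPositive (μ.isPositive A hA) v),
    ← inner_eq_re_of_isPositive (μ.isPositive A hA)]

theorem PosTraceClassMeasure.isOperatorForm_scalar {A : Set α} (hA : MeasurableSet A) :
    IsOperatorForm fun v => ((μ.scalar v).real A : ℂ) := by
  intro L hL
  simp_rw [μ.scalar_real _ hA]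
  exact hL _

/-- The scalar measure `A ↦ tr μ(A)`. -/
def PosTraceClassMeasure.trace : Measure α :=
  Measure.sum fun j => μ.scalar (onb V j)

/-- Positivity makes the trace norm the sum of the diagonal entries, so trace norms of values of `μ`
are themselves a measure. -/
theorem PosTraceClassMeasure.trace_apply {A : Set α} (hA : MeasurableSet A) :
    μ.trace A = traceNorm (μ.toFun A) := by
  rw [trace, Measure.sum_apply _ hA, traceNorm_of_isPositive (onb V) (μ.isPositive A hA)]
  exact tsum_congr fun j => μ.scalar_apply _ hA

instance : IsFiniteMeasure μ.trace :=
  ⟨by rw [μ.trace_apply MeasurableSet.univ]; exact μ.isTraceClass _ MeasurableSet.univ⟩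

theorem PosTraceClassMeasure.eq_of_scalar_eq {μ ν : PosTraceClassMeasure α V}
    (h : ∀ v, μ.scalar v = ν.scalar v) : μ = ν := by
  ext1
  funext A
  by_cases hA : MeasurableSet A
  · refine ext_inner_self fun v => ?_
    rw [← μ.scalar_real v hA, ← ν.scalar_real v hA, h]
  · rw [μ.not_measurable A hA, ν.not_measurable A hA]

end ScalarMeasure

/-! ### Integrals against an operator-valued measure. -/

section Integrals

variable {α : Type*} [MeasurableSpace α] {V : Type*} [NormedAddCommGroup V]
  [InnerProductSpace ℂ V] [CompleteSpace V] (μ : PosTraceClassMeasure α V)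

theorem isPositive_simpleIntegral (F : SimpleFunc α ℝ≥0) : (simpleIntegral μ F).IsPositive := by
  rw [← ContinuousLinearMap.nonneg_iff_isPositive]
  refine Finset.sum_nonneg fun c _ => ?_
  rw [ContinuousLinearMap.nonneg_iff_isPositive, isPositive_iff_inner_nonneg]
  intro v
  rw [smul_apply, inner_smul_right]
  refine mul_nonneg (by exact_mod_cast c.coe_nonneg) ?_
  exact isPositive_iff_inner_nonneg.1 (μ.isPositive _ (F.measurableSet_fiber c)) v

theorem ofReal_inner_simpleIntegral (F : SimpleFunc α ℝ≥0) (v : V) :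
    ENNReal.ofReal (⟪v, simpleIntegral μ F v⟫_ℂ).re = ∫⁻ x, F x ∂(μ.scalar v) := by
  have h1 : ∫⁻ x, F x ∂(μ.scalar v) = (F.map ((↑) : ℝ≥0 → ℝ≥0∞)).lintegral (μ.scalar v) := by
    rw [← SimpleFunc.lintegral_eq_lintegral]; rfl
  rw [h1, SimpleFunc.map_lintegral, simpleIntegral, sum_apply, inner_sum,
    Complex.re_sum, ENNReal.ofReal_sum_of_nonneg]
  · refine Finset.sum_congr rfl fun c _ => ?_
    rw [smul_apply, inner_smul_right, Complex.re_ofReal_mul,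
      ENNReal.ofReal_mul c.coe_nonneg, ENNReal.ofReal_coe_nnreal,
      μ.scalar_apply v (F.measurableSet_fiber c)]
  · intro c _
    rw [smul_apply, inner_smul_right, Complex.re_ofReal_mul]
    exact mul_nonneg c.coe_nonneg (re_inner_nonneg_of_isPositive
      (μ.isPositive _ (F.measurableSet_fiber c)) v)

variable {μ}

theorem HasNonnegIntegral.isPositive {f : α → ℝ≥0} {T : V →L[ℂ] V}
    (h : HasNonnegIntegral μ f T) : T.IsPositive := by
  obtain ⟨-, F, -, -, -, hlim⟩ := h
  rw [isPositive_iff_inner_nonneg]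
  intro v
  exact ge_of_tendsto' (tendsto_inner_apply (tendsto_of_tendsto_traceNorm hlim) v v) fun n =>
    isPositive_iff_inner_nonneg.1 (isPositive_simpleIntegral μ (F n)) v

/-- Monotone convergence for each scalar measure. The right side does not involve the approximating
sequence, so the integral is independent of it. -/
theorem HasNonnegIntegral.ofReal_inner {f : α → ℝ≥0} {T : V →L[ℂ] V}
    (h : HasNonnegIntegral μ f T) (v : V) :
    ENNReal.ofReal (⟪v, T v⟫_ℂ).re = ∫⁻ x, f x ∂(μ.scalar v) := by
  obtain ⟨-, F, hmono, hF, -, hlim⟩ := h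
  have h1 := (ENNReal.continuous_ofReal.tendsto _).comp ((Complex.continuous_re.tendsto _).comp
    (tendsto_inner_apply (tendsto_of_tendsto_traceNorm hlim) v v))
  have h2 : Tendsto (fun n => ∫⁻ x, F n x ∂(μ.scalar v)) atTop (𝓝 (∫⁻ x, f x ∂(μ.scalar v))) := by
    refine lintegral_tendsto_of_tendsto_of_monotone
      (fun n => (F n).measurable.coe_nnreal_ennreal.aemeasurable) ?_ ?_
    · exact ae_of_all _ fun x m n hmn => ENNReal.coe_le_coe.2 (hmono hmn x)
    · exact ae_of_all _ fun x => (ENNReal.continuous_coe.tendsto _).comp (hF x)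
  refine tendsto_nhds_unique h1 (h2.congr fun n => ?_)
  rw [← ofReal_inner_simpleIntegral]
  rfl

theorem HasNonnegIntegral.inner_eq {f : α → ℝ≥0} {T : V →L[ℂ] V}
    (h : HasNonnegIntegral μ f T) (hf : Measurable f) (v : V) :
    ⟪v, T v⟫_ℂ = ((∫ x, (f x : ℝ) ∂(μ.scalar v) : ℝ) : ℂ) := by
  rw [inner_eq_re_of_isPositive h.isPositive, integral_eq_lintegral_of_nonneg_ae
    (ae_of_all _ fun x => (f x).coe_nonneg) hf.coe_nnreal_real.aestronglyMeasurable]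
  simp_rw [ENNReal.ofReal_coe_nnreal]
  rw [← h.ofReal_inner v, ENNReal.toReal_ofReal (re_inner_nonneg_of_isPositive h.isPositive v)]

variable (μ)

/-- The operator is obtained from the form `v ↦ ∫ f d(μ.scalar v)`. Its distance in trace norm to
the integral of a simple function below `f` is the integral of the difference against `μ.trace`,
which tends to 0 by dominated convergence. -/
theorem exists_hasNonnegIntegral {f : α → ℝ≥0} (hf : Measurable f) {C : ℝ≥0} (hC : ∀ x, f x ≤ C) :
    ∃ T, HasNonnegIntegral μ f T := by
  have hint : ∀ (ν : Measure α) [IsFiniteMeasure ν], Integrable (fun x => (f x : ℝ)) ν := fun ν _ =>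
    Integrable.of_bound (C := C) hf.coe_nnreal_real.aestronglyMeasurable
      (ae_of_all _ fun x => by
        rw [Real.norm_of_nonneg (f x).coe_nonneg]; exact_mod_cast hC x)
  have hq := isOperatorForm_integral (m := μ.scalar) (fun A hA => μ.isOperatorForm_scalar hA)
    (fun v => hint (μ.scalar v))
  obtain ⟨T, hT⟩ := hq.exists_operator (C := C * ‖μ.toFun Set.univ‖) (fun v => by
    have h0 : 0 ≤ ∫ x, (f x : ℝ) ∂(μ.scalar v) := integral_nonneg fun x => (f x).coe_nonneg
    rw [Complex.norm_real, Real.norm_of_nonneg h0]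
    have h1 : ∫ x, (f x : ℝ) ∂(μ.scalar v) ≤ ∫ x, (C : ℝ) ∂(μ.scalar v) :=
      integral_mono (hint _) (integrable_const _) fun x => by exact_mod_cast hC x
    rw [integral_const, smul_eq_mul] at h1
    have h2 : (μ.scalar v).real Set.univ ≤ ‖μ.toFun Set.univ‖ * ‖v‖ ^ 2 := by
      have h3 := congrArg norm (μ.scalar_real v MeasurableSet.univ)
      rw [Complex.norm_real, Real.norm_of_nonneg measureReal_nonneg] at h3
      rw [h3]
      refine (norm_inner_le_norm _ _).trans ?_
      have := (μ.toFun Set.univ).le_opNorm v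
      nlinarith [norm_nonneg v]
    calc _ ≤ _ := h1
      _ ≤ (‖μ.toFun Set.univ‖ * ‖v‖ ^ 2) * C := by gcongr
      _ = _ := by ring)
  let F : ℕ → SimpleFunc α ℝ≥0 := fun n =>
    (SimpleFunc.eapprox (fun x => (f x : ℝ≥0∞)) n).map ENNReal.toNNReal
  have hFe : ∀ n x, ((F n x : ℝ≥0) : ℝ≥0∞) = SimpleFunc.eapprox (fun x => (f x : ℝ≥0∞)) n x :=
    fun n x => ENNReal.coe_toNNReal (SimpleFunc.eapprox_lt_top _ n x).ne
  have hFmono : Monotone F := fun m n hmn x => by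
    have h1 : ((F m x : ℝ≥0) : ℝ≥0∞) ≤ F n x := by
      rw [hFe, hFe]; exact SimpleFunc.monotone_eapprox _ hmn x
    exact_mod_cast h1
  have hFlim : ∀ x, Tendsto (fun n => F n x) atTop (𝓝 (f x)) := fun x => by
    rw [← ENNReal.tendsto_coe]
    simp_rw [hFe]
    exact SimpleFunc.tendsto_eapprox hf.coe_nnreal_ennreal x
  have hFle : ∀ n x, F n x ≤ f x := fun n x =>
    Monotone.ge_of_tendsto (fun m n hmn => hFmono hmn x) (hFlim x) n
  have hdiff : ∀ n v, ⟪v, (T - simpleIntegral μ (F n)) v⟫_ℂ =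
      ((∫ x, ((f x - F n x : ℝ≥0) : ℝ) ∂(μ.scalar v) : ℝ) : ℂ) := fun n v => by
    have hFi : Integrable (fun x => (F n x : ℝ)) (μ.scalar v) :=
      (hint (μ.scalar v)).mono' (F n).measurable.coe_nnreal_real.aestronglyMeasurable
        (ae_of_all _ fun x => by
          rw [Real.norm_of_nonneg (F n x).coe_nonneg]; exact_mod_cast hFle n x)
    simp_rw [fun x => NNReal.coe_sub (hFle n x)]
    rw [integral_sub (hint _) hFi, sub_apply, inner_sub_right, hT,
      inner_eq_re_of_isPositive (isPositive_simpleIntegral μ (F n))]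
    push_cast
    congr 2
    rw [integral_eq_lintegral_of_nonneg_ae (ae_of_all _ fun x => (F n x).coe_nonneg) hFi.1]
    simp_rw [ENNReal.ofReal_coe_nnreal]
    rw [← ofReal_inner_simpleIntegral, ENNReal.toReal_ofReal
      (re_inner_nonneg_of_isPositive (isPositive_simpleIntegral μ (F n)) v)]
  have hTpos : T.IsPositive := isPositive_iff_inner_nonneg.2 fun v => by
    rw [hT]; exact_mod_cast integral_nonneg fun x => (f x).coe_nonneg
  have hdpos : ∀ n, (T - simpleIntegral μ (F n)).IsPositive := fun n =>
    isPositive_iff_inner_nonneg.2 fun v => by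
      rw [hdiff]; exact_mod_cast integral_nonneg fun x => (f x - F n x).coe_nonneg
  have htr : ∀ (g : α → ℝ≥0) (S : V →L[ℂ] V), Measurable g → (∀ x, g x ≤ f x) → S.IsPositive →
      (∀ v, ⟪v, S v⟫_ℂ = ((∫ x, (g x : ℝ) ∂(μ.scalar v) : ℝ) : ℂ)) →
      traceNorm S = ∫⁻ x, g x ∂μ.trace := fun g S hg hgf hS hSv => by
    rw [traceNorm_of_isPositive (onb V) hS, PosTraceClassMeasure.trace, lintegral_sum_measure]
    refine tsum_congr fun j => ?_
    rw [hSv, Complex.ofReal_re, ofReal_integral_eq_lintegral_ofReal]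
    · simp_rw [ENNReal.ofReal_coe_nnreal]
    · exact (hint _).mono' hg.coe_nnreal_real.aestronglyMeasurable
        (ae_of_all _ fun x => by rw [Real.norm_of_nonneg (g x).coe_nonneg]; exact_mod_cast hgf x)
    · exact ae_of_all _ fun x => (g x).coe_nonneg
  have hfin : ∫⁻ x, f x ∂μ.trace < ∞ := by
    have := (hint μ.trace).2
    refine lt_of_le_of_lt (lintegral_mono fun x => ?_) this
    simp only [← ofReal_norm]
    rw [Real.norm_of_nonneg (f x).coe_nonneg, ENNReal.ofReal_coe_nnreal]
  have hTtr : IsTraceClass T := by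
    rw [IsTraceClass, htr f T hf (fun _ => le_rfl) hTpos hT]
    exact hfin
  -- The limit itself serves as the dominating trace-class operator.
  refine ⟨T, hTtr, F, hFmono, hFlim, ⟨T, hTpos, hTtr, hdpos⟩, ?_⟩
  have h1 : ∀ n, traceNorm (simpleIntegral μ (F n) - T) =
      ∫⁻ x, ((f x - F n x : ℝ≥0) : ℝ≥0∞) ∂μ.trace := fun n => by
    rw [traceNorm_sub_comm]
    exact htr _ _ (hf.sub (F n).measurable) (fun x => tsub_le_self) (hdpos n) (hdiff n)
  simp_rw [h1]
  rw [← lintegral_zero (μ := μ.trace)]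
  refine tendsto_lintegral_of_dominated_convergence (fun x => (f x : ℝ≥0∞))
    (fun n => (hf.sub (F n).measurable).coe_nnreal_ennreal)
    (fun n => ae_of_all _ fun x => ENNReal.coe_le_coe.2 tsub_le_self) hfin.ne
    (ae_of_all _ fun x => ?_)
  have h2 : Tendsto (fun n => f x - F n x) atTop (𝓝 (f x - f x)) :=
    tendsto_const_nhds.sub (hFlim x)
  rw [tsub_self] at h2
  exact_mod_cast (ENNReal.continuous_coe.tendsto _).comp h2

variable {μ}

theorem HasIntegral.isTraceClass {f : α → ℂ} {T : V →L[ℂ] V} (h : HasIntegral μ f T) :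
    IsTraceClass T := by
  obtain ⟨R₁, R₂, I₁, I₂, hR₁, hR₂, hI₁, hI₂, rfl⟩ := h
  refine (hR₁.1.sub hR₂.1).add ?_
  rw [IsTraceClass, traceNorm_smul_of_norm_eq_one Complex.norm_I]
  exact hI₁.1.sub hI₂.1

theorem HasIntegral.inner_eq {f : α → ℂ} {T : V →L[ℂ] V} (h : HasIntegral μ f T)
    (hf : Measurable f) {C : ℝ} (hC : ∀ x, ‖f x‖ ≤ C) (v : V) :
    ⟪v, T v⟫_ℂ = ∫ x, f x ∂(μ.scalar v) := by
  obtain ⟨R₁, R₂, I₁, I₂, hR₁, hR₂, hI₁, hI₂, rfl⟩ := h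
  have hfi : Integrable f (μ.scalar v) :=
    Integrable.of_bound hf.aestronglyMeasurable C (ae_of_all _ hC)
  have hre : Measurable fun x => (f x).re := Complex.measurable_re.comp hf
  have him : Measurable fun x => (f x).im := Complex.measurable_im.comp hf
  have key : ∀ {g : α → ℝ}, Integrable g (μ.scalar v) →
      ∫ x, ((g x).toNNReal : ℝ) ∂(μ.scalar v) - ∫ x, ((-g x).toNNReal : ℝ) ∂(μ.scalar v) =
        ∫ x, g x ∂(μ.scalar v) := fun {g} hg => by
    have hneg : Integrable (fun x => ((-g x).toNNReal : ℝ)) (μ.scalar v) := hg.neg.real_toNNReal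
    rw [← integral_sub hg.real_toNNReal hneg]
    simp_rw [Real.coe_toNNReal', max_zero_sub_max_neg_zero_eq_self]
  rw [add_apply, smul_apply, sub_apply, sub_apply, inner_add_right,
    inner_smul_right, inner_sub_right, inner_sub_right, hR₁.inner_eq hre.real_toNNReal,
    hR₂.inner_eq hre.neg.real_toNNReal, hI₁.inner_eq him.real_toNNReal,
    hI₂.inner_eq him.neg.real_toNNReal, ← Complex.ofReal_sub, ← Complex.ofReal_sub,
    key (g := fun x => (f x).re) hfi.re, key (g := fun x => (f x).im) hfi.im,
    ← integral_re_add_im hfi, mul_comm]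
  rfl

variable (μ) in
theorem exists_hasIntegral {f : α → ℂ} (hf : Measurable f) {C : ℝ≥0} (hC : ∀ x, ‖f x‖ ≤ C) :
    ∃ T, HasIntegral μ f T := by
  have hre : Measurable fun x => (f x).re := Complex.measurable_re.comp hf
  have him : Measurable fun x => (f x).im := Complex.measurable_im.comp hf
  have hle : ∀ {a : ℝ}, |a| ≤ C → a.toNNReal ≤ C := fun {a} ha =>
    Real.toNNReal_le_iff_le_coe.2 ((le_abs_self a).trans ha)
  obtain ⟨R₁, h₁⟩ := exists_hasNonnegIntegral μ hre.real_toNNReal fun x =>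
    hle ((Complex.abs_re_le_norm _).trans (hC x))
  obtain ⟨R₂, h₂⟩ := exists_hasNonnegIntegral μ hre.neg.real_toNNReal fun x =>
    hle ((abs_neg _).trans_le ((Complex.abs_re_le_norm _).trans (hC x)))
  obtain ⟨I₁, h₃⟩ := exists_hasNonnegIntegral μ him.real_toNNReal fun x =>
    hle ((Complex.abs_im_le_norm _).trans (hC x))
  obtain ⟨I₂, h₄⟩ := exists_hasNonnegIntegral μ him.neg.real_toNNReal fun x =>
    hle ((abs_neg _).trans_le ((Complex.abs_im_le_norm _).trans (hC x)))
  exact ⟨_, R₁, R₂, I₁, I₂, h₁, h₂, h₃, h₄, rfl⟩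

end Integrals

/-! ### Assembling an operator-valued measure from scalar ones. -/

section Construction

variable {α : Type*} [MeasurableSpace α] {V : Type*} [NormedAddCommGroup V]
  [InnerProductSpace ℂ V] [CompleteSpace V]

/-- Finite scalar measures which depend on `v` like a quadratic form come from an operator-valued
measure, if their total mass is given by a trace-class operator. -/
theorem exists_posTraceClassMeasure (m : V → Measure α) [∀ v, IsFiniteMeasure (m v)]
    (hm : ∀ A, MeasurableSet A → IsOperatorForm fun v => ((m v).real A : ℂ)) {S : V →L[ℂ] V}
    (hS : IsTraceClass S) (hmS : ∀ v, ((m v).real Set.univ : ℂ) = ⟪v, S v⟫_ℂ) :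
    ∃ μ : PosTraceClassMeasure α V, ∀ v, μ.scalar v = m v := by
  classical
  have hex : ∀ A, MeasurableSet A → ∃ T : V →L[ℂ] V, ∀ v, ⟪v, T v⟫_ℂ = ((m v).real A : ℂ) :=
    fun A hA => (hm A hA).exists_operator (C := ‖S‖) fun v => by
      rw [Complex.norm_real, Real.norm_of_nonneg measureReal_nonneg]
      calc (m v).real A ≤ (m v).real Set.univ := measureReal_mono (Set.subset_univ A)
        _ = ‖⟪v, S v⟫_ℂ‖ := by
          rw [← hmS, Complex.norm_real, Real.norm_of_nonneg measureReal_nonneg]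
        _ ≤ ‖v‖ * (‖S‖ * ‖v‖) := (norm_inner_le_norm _ _).trans (by gcongr; exact S.le_opNorm v)
        _ = ‖S‖ * ‖v‖ ^ 2 := by ring
  choose T hT using hex
  have hpos : ∀ A hA, (T A hA).IsPositive := fun A hA => isPositive_iff_inner_nonneg.2 fun v => by
    rw [hT]; exact_mod_cast measureReal_nonneg
  have hSpos : S.IsPositive := isPositive_iff_inner_nonneg.2 fun v => by
    rw [← hmS]; exact_mod_cast measureReal_nonneg
  let M : Measure α := Measure.sum fun j => m (onb V j)
  have hM : ∀ A hA, traceNorm (T A hA) = M A := fun A hA => by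
    rw [traceNorm_of_isPositive (onb V) (hpos A hA), Measure.sum_apply _ hA]
    refine tsum_congr fun j => ?_
    rw [hT, Complex.ofReal_re, ofReal_measureReal]
  have hMfin : IsFiniteMeasure M := by
    refine ⟨?_⟩
    have : T Set.univ MeasurableSet.univ = S := ext_inner_self fun v => by rw [hT, hmS]
    rw [← hM _ MeasurableSet.univ, this]
    exact hS
  let μ : PosTraceClassMeasure α V :=
    { toFun := fun A => if hA : MeasurableSet A then T A hA else 0
      isPositive := fun A hA => by simp only [hA, dif_pos, hpos]
      isTraceClass := fun A hA => by
        simp only [hA, dif_pos, IsTraceClass, hM]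
        exact measure_lt_top _ _
      not_measurable := fun A hA => by simp only [hA, dif_neg, not_false_eq_true]
      iUnion := fun A hA hd => by
        have hU := MeasurableSet.iUnion hA
        simp only [hA, hU, dif_pos]
        let B : ℕ → Set α := fun n => ⋃ i ∈ Finset.range n, A i
        have hB : ∀ n, MeasurableSet (B n) := fun n =>
          Finset.measurableSet_biUnion _ fun i _ => hA i
        have hBU : ∀ n, B n ⊆ ⋃ i, A i := fun n =>
          Set.iUnion₂_subset fun i _ => Set.subset_iUnion A i
        let R : ℕ → Set α := fun n => (⋃ i, A i) \ B n
        have hR : ∀ n, MeasurableSet (R n) := fun n => hU.diff (hB n)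
        -- The remainder of the series is the positive operator of the tail set, so its trace norm
        -- is `M (R n)`.
        have hTR : ∀ n, T (⋃ i, A i) hU - ∑ i ∈ Finset.range n, T (A i) (hA i) = T (R n) (hR n) :=
          fun n => ext_inner_self fun v => by
            rw [sub_apply, sum_apply, inner_sub_right, inner_sum, hT, hT]
            simp_rw [hT]
            rw [measureReal_sdiff (hBU n) (hB n),
              measureReal_biUnion_finset (fun i _ j _ hij => hd i j hij) fun i _ => hA i]
            push_cast
            rfl
        have htr : ∀ n, traceNorm (∑ i ∈ Finset.range n, T (A i) (hA i) - T (⋃ i, A i) hU) =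
            M (R n) := fun n => by
          rw [traceNorm_sub_comm, hTR, hM]
        simp_rw [htr]
        have hRanti : Antitone R := fun k n hkn => Set.sdiff_subset_sdiff_right
          (Set.biUnion_subset_biUnion_left fun i hi =>
            Finset.mem_coe.2 (Finset.range_mono hkn hi))
        have hRempty : ⋂ n, R n = ∅ := by
          refine Set.eq_empty_of_forall_notMem fun x hx => ?_
          rw [Set.mem_iInter] at hx
          obtain ⟨i, hi⟩ := Set.mem_iUnion.1 (hx 0).1
          exact (hx (i + 1)).2 (Set.mem_biUnion (by simp) hi)
        have := tendsto_measure_iInter_atTop (μ := M) (fun n => (hR n).nullMeasurableSet) hRanti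
          ⟨0, measure_ne_top _ _⟩
        rwa [hRempty, measure_empty] at this }
  refine ⟨μ, fun v => Measure.ext fun A hA => ?_⟩
  have h1 : μ.toFun A = T A hA := dif_pos hA
  rw [μ.scalar_apply v hA, h1, hT, Complex.ofReal_re, ofReal_measureReal]

end Construction

/-! ### Elementary relations between the notions of positive definiteness. -/

section PositiveDefiniteFamilies

variable {V : Type*} [NormedAddCommGroup V] [InnerProductSpace ℂ V]

theorem CompletelyPositiveDefinite.weaklyPositiveDefinite {G : Type*} [AddGroup G]
    {K : G → V →L[ℂ] V} (h : CompletelyPositiveDefinite K) : WeaklyPositiveDefinite K := by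
  intro n c t
  rw [isPositive_iff_inner_nonneg]
  intro v
  convert h n (fun j => star (c j) • v) t using 1
  rw [sum_apply, inner_sum]
  refine Finset.sum_congr rfl fun j _ => ?_
  rw [sum_apply, inner_sum]
  refine Finset.sum_congr rfl fun k _ => ?_
  rw [smul_apply, inner_smul_right, map_smul, inner_smul_left, inner_smul_right,
    Complex.star_def, Complex.conj_conj, mul_assoc]

theorem WeaklyPositiveDefinite.isPosDef {G : Type*} [AddGroup G]
    {K : G → V →L[ℂ] V} (h : WeaklyPositiveDefinite K) (v : V) :
    IsPosDef fun t => ⟪v, K t v⟫_ℂ := by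
  intro n c t
  have h1 := isPositive_iff_inner_nonneg.1 (h n c t) v
  simpa [inner_sum, inner_smul_right] using h1

end PositiveDefiniteFamilies

/-! ### Complete positivity of integrals. -/

section CompletePositivity

variable {α : Type*} [MeasurableSpace α] {V : Type*} [NormedAddCommGroup V]
  [InnerProductSpace ℂ V]

theorem tendsto_polarize {κ : Type*} {l : Filter κ} {q : κ → V → ℂ} {q₀ : V → ℂ}
    (h : ∀ v, Tendsto (fun i => q i v) l (𝓝 (q₀ v))) (x y : V) :
    Tendsto (fun i => polarize (q i) x y) l (𝓝 (polarize q₀ x y)) :=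
  ((((h _).sub (h _)).sub ((h _).const_mul _)).add ((h _).const_mul _)).div_const _

variable [CompleteSpace V]

/-- On the set where `H = y` the double sum collapses to `⟪g, μ(H = y) g⟫` with `g = ∑ conj(yⱼ) fⱼ`,
and every such term is nonnegative. -/
theorem sum_polarize_simpleFunc_nonneg (μ : PosTraceClassMeasure α V) {n : ℕ}
    (H : SimpleFunc α (Fin n → ℂ)) (f : Fin n → V) :
    0 ≤ ∑ j, ∑ k, polarize (fun v => ∫ x, H x j * starRingEnd ℂ (H x k) ∂(μ.scalar v))
      (f j) (f k) := by
  have hpol : ∀ j k, polarize (fun v => ∫ x, H x j * starRingEnd ℂ (H x k) ∂(μ.scalar v))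
      (f j) (f k) = ∑ y ∈ H.range, (y j * starRingEnd ℂ (y k)) *
        ⟪f j, μ.toFun (H ⁻¹' {y}) (f k)⟫_ℂ := fun j k => by
    have h1 : (fun v => ∫ x, H x j * starRingEnd ℂ (H x k) ∂(μ.scalar v)) = fun v =>
        ⟪v, (∑ y ∈ H.range, (y j * starRingEnd ℂ (y k)) • μ.toFun (H ⁻¹' {y})) v⟫_ℂ := by
      funext v
      have h2 : ∫ x, H x j * starRingEnd ℂ (H x k) ∂(μ.scalar v) =
          (H.map fun y => y j * starRingEnd ℂ (y k)).integral (μ.scalar v) := by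
        rw [SimpleFunc.integral_eq_integral _ (SimpleFunc.integrable_of_isFiniteMeasure _)]
        rfl
      rw [h2, SimpleFunc.map_integral _ _ (SimpleFunc.integrable_of_isFiniteMeasure _) (by simp),
        sum_apply, inner_sum]
      refine Finset.sum_congr rfl fun y _ => ?_
      rw [smul_apply, inner_smul_right, Complex.real_smul,
        μ.scalar_real v (H.measurableSet_fiber y), mul_comm]
    rw [h1, polarize_inner, sum_apply, inner_sum]
    refine Finset.sum_congr rfl fun y _ => ?_
    rw [smul_apply, inner_smul_right]
  simp_rw [hpol]
  have hswap : ∑ j, ∑ k, ∑ y ∈ H.range, (y j * starRingEnd ℂ (y k)) *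
        ⟪f j, μ.toFun (H ⁻¹' {y}) (f k)⟫_ℂ =
      ∑ y ∈ H.range, ⟪∑ j, starRingEnd ℂ (y j) • f j,
        μ.toFun (H ⁻¹' {y}) (∑ k, starRingEnd ℂ (y k) • f k)⟫_ℂ := by
    simp_rw [Finset.sum_comm (t := H.range)]
    refine Finset.sum_congr rfl fun y _ => ?_
    simp_rw [map_sum, sum_inner, inner_sum, map_smul, inner_smul_left, inner_smul_right,
      Complex.conj_conj, mul_assoc]
  rw [hswap]
  exact Finset.sum_nonneg fun y _ =>
    isPositive_iff_inner_nonneg.1 (μ.isPositive _ (H.measurableSet_fiber y)) _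

theorem sum_polarize_integral_nonneg (μ : PosTraceClassMeasure α V) {n : ℕ}
    {e : α → Fin n → ℂ} (he : Measurable e) {C : ℝ} (hC : ∀ x, ‖e x‖ ≤ C) (f : Fin n → V) :
    0 ≤ ∑ j, ∑ k, polarize (fun v => ∫ x, e x j * starRingEnd ℂ (e x k) ∂(μ.scalar v))
      (f j) (f k) := by
  let H := he.stronglyMeasurable.approxBounded C
  have hH : ∀ x, Tendsto (fun i => H i x) atTop (𝓝 (e x)) := fun x =>
    he.stronglyMeasurable.tendsto_approxBounded_of_norm_le (hC x)
  have hint : ∀ (j k : Fin n) (v : V),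
      Tendsto (fun i => ∫ x, H i x j * starRingEnd ℂ (H i x k) ∂(μ.scalar v)) atTop
        (𝓝 (∫ x, e x j * starRingEnd ℂ (e x k) ∂(μ.scalar v))) := fun j k v => by
    have hcont : Continuous fun y : Fin n → ℂ => y j * starRingEnd ℂ (y k) :=
      (continuous_apply j).mul (Complex.continuous_conj.comp (continuous_apply k))
    refine tendsto_integral_of_dominated_convergence (fun _ => C * C)
      (fun i => (hcont.measurable.comp (H i).measurable).aestronglyMeasurable)
      (integrable_const _) (fun i => ae_of_all _ fun x => ?_)
      (ae_of_all _ fun x => (hcont.tendsto _).comp (hH x))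
    have hC0 : 0 ≤ C := (norm_nonneg _).trans (hC x)
    have hb : ‖H i x‖ ≤ C := he.stronglyMeasurable.norm_approxBounded_le hC0 i x
    rw [norm_mul, RCLike.norm_conj]
    exact mul_le_mul ((norm_le_pi_norm _ _).trans hb) ((norm_le_pi_norm _ _).trans hb)
      (norm_nonneg _) hC0
  refine ge_of_tendsto' (tendsto_finsetSum _ fun j _ => tendsto_finsetSum _ fun k _ =>
    tendsto_polarize (hint j k) (f j) (f k)) fun i => sum_polarize_simpleFunc_nonneg μ (H i) f

end CompletePositivity

/-! ### Characters and the representation of positive definite families. -/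

section Characters

variable {d : ℕ} {V : Type*} [NormedAddCommGroup V] [InnerProductSpace ℂ V] [CompleteSpace V]

theorem expChar_eq (t x : EuclideanSpace ℝ (Fin d)) :
    expChar t x = Complex.exp ((⟪x, t⟫_ℝ : ℝ) * Complex.I) := by
  rw [expChar, mul_comm, real_inner_comm]

theorem measurable_expChar (t : EuclideanSpace ℝ (Fin d)) : Measurable (expChar t) := by
  have : Continuous (expChar t) := by
    unfold expChar
    fun_prop
  exact this.measurable

theorem norm_expChar (t x : EuclideanSpace ℝ (Fin d)) : ‖expChar t x‖ = 1 := by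
  rw [expChar_eq, Complex.norm_exp_ofReal_mul_I]

theorem integral_expChar (m : Measure (EuclideanSpace ℝ (Fin d)))
    (t : EuclideanSpace ℝ (Fin d)) : ∫ x, expChar t x ∂m = charFun m t := by
  simp_rw [charFun_apply, expChar_eq]

theorem expChar_sub (s t x : EuclideanSpace ℝ (Fin d)) :
    expChar (s - t) x = expChar s x * starRingEnd ℂ (expChar t x) := by
  rw [expChar_eq, expChar_eq, expChar_eq, ← Complex.exp_conj, ← Complex.exp_add, inner_sub_right,
    map_mul, Complex.conj_ofReal, Complex.conj_I]
  push_cast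
  ring_nf

variable {μ : PosTraceClassMeasure (EuclideanSpace ℝ (Fin d)) V}

theorem HasIntegral.inner_eq_charFun {t : EuclideanSpace ℝ (Fin d)} {S : V →L[ℂ] V}
    (h : HasIntegral μ (expChar t) S) (v : V) : ⟪v, S v⟫_ℂ = charFun (μ.scalar v) t := by
  rw [h.inner_eq (measurable_expChar t) (C := 1) (fun x => (norm_expChar t x).le) v,
    integral_expChar]

/-- Some integral exists because characters are bounded, and a quadratic form determines its
operator; so a scalar identity already identifies the operator integral. -/
theorem hasIntegral_expChar_iff {t : EuclideanSpace ℝ (Fin d)} {S : V →L[ℂ] V} :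
    HasIntegral μ (expChar t) S ↔ ∀ v, ⟪v, S v⟫_ℂ = charFun (μ.scalar v) t := by
  refine ⟨HasIntegral.inner_eq_charFun, fun h => ?_⟩
  obtain ⟨T, hT⟩ := exists_hasIntegral μ (measurable_expChar t) (C := 1)
    fun x => by simp [norm_expChar]
  have : S = T := ext_inner_self fun v => by rw [h, hT.inner_eq_charFun]
  rwa [this]

/-- The form of `K (tⱼ - tₖ)` integrates `eⱼ * conj eₖ`, with `eⱼ` the character of `tⱼ`; polarizing
it recovers the mixed terms `⟪fⱼ, K (tⱼ - tₖ) fₖ⟫`. -/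
theorem completelyPositiveDefinite_of_hasIntegral
    {K : EuclideanSpace ℝ (Fin d) → V →L[ℂ] V} (h : ∀ t, HasIntegral μ (expChar t) (K t)) :
    CompletelyPositiveDefinite K := by
  intro n f t
  have h1 := sum_polarize_integral_nonneg μ (e := fun x j => expChar (t j) x)
    (measurable_pi_lambda _ fun j => measurable_expChar (t j)) (C := 1)
    (fun x => (pi_norm_le_iff_of_nonneg zero_le_one).2 fun j => (norm_expChar (t j) x).le) f
  convert h1 using 4 with j _ k _
  rw [← polarize_inner]
  congr 1
  funext v
  simp_rw [(h _).inner_eq_charFun, ← expChar_sub, integral_expChar]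

theorem existsUnique_measure {K : EuclideanSpace ℝ (Fin d) → V →L[ℂ] V}
    (htr : IsTraceClass (K 0)) (hK : WeaklyPositiveDefinite K)
    (hc : Tendsto (fun t => traceNorm (K t - K 0)) (𝓝 0) (𝓝 0)) :
    ∃! μ : PosTraceClassMeasure (EuclideanSpace ℝ (Fin d)) V,
      ∀ t, HasIntegral μ (expChar t) (K t) := by
  choose m hm hmK using fun v => (hK.isPosDef v).exists_charFun_eq
    (tendsto_inner_apply (tendsto_of_tendsto_traceNorm hc) v v)
  obtain ⟨μ, hμ⟩ := exists_posTraceClassMeasure m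
    (fun A hA => isOperatorForm_measureReal_of_charFun hmK hA) htr
    (fun v => by rw [← charFun_zero, hmK])
  refine ⟨μ, fun t => hasIntegral_expChar_iff.2 fun v => by rw [hμ, hmK], fun ν hν => ?_⟩
  refine PosTraceClassMeasure.eq_of_scalar_eq fun v => ?_
  refine Measure.ext_of_charFun (funext fun t => ?_)
  rw [← (hν t).inner_eq_charFun, hμ, hmK]

end Characters

end OperatorBochner

end

/-! ### The operator-valued Bochner theorem. -/

theorem theorem4p1 (d : ℕ) (V : Type*) [NormedAddCommGroup V] [InnerProductSpace ℂ V]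
    [CompleteSpace V] [TopologicalSpace.SeparableSpace V] :
    -- existence and uniqueness of the representing measure
    (∀ K : EuclideanSpace ℝ (Fin d) → V →L[ℂ] V,
      (∀ t, OperatorBochner.IsTraceClass (K t)) →
      OperatorBochner.WeaklyPositiveDefinite K →
      Tendsto (fun t => OperatorBochner.traceNorm (K t - K 0)) (𝓝 0) (𝓝 0) →
      ∃! μ : OperatorBochner.PosTraceClassMeasure (EuclideanSpace ℝ (Fin d)) V,
        ∀ t, OperatorBochner.HasIntegral μ (OperatorBochner.expChar t) (K t)) ∧
    -- converse: the integrals exist, are unambiguous, and form a positive-definite family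
    (∀ μ : OperatorBochner.PosTraceClassMeasure (EuclideanSpace ℝ (Fin d)) V,
      ∃ K : EuclideanSpace ℝ (Fin d) → V →L[ℂ] V,
        (∀ t S, OperatorBochner.HasIntegral μ (OperatorBochner.expChar t) S ↔ S = K t) ∧
        (∀ t, OperatorBochner.IsTraceClass (K t)) ∧
        OperatorBochner.WeaklyPositiveDefinite K ∧
        OperatorBochner.CompletelyPositiveDefinite K) ∧
    -- corollary: weak and complete positive definiteness agree
    (∀ K : EuclideanSpace ℝ (Fin d) → V →L[ℂ] V,
      (∀ t, OperatorBochner.IsTraceClass (K t)) →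
      Tendsto (fun t => OperatorBochner.traceNorm (K t - K 0)) (𝓝 0) (𝓝 0) →
      (OperatorBochner.WeaklyPositiveDefinite K ↔
        OperatorBochner.CompletelyPositiveDefinite K)) := by
  refine ⟨fun K htr hK hc => OperatorBochner.existsUnique_measure (htr 0) hK hc, fun μ => ?_,
    fun K htr hc => ⟨fun hK => ?_, fun hK => hK.weaklyPositiveDefinite⟩⟩
  · choose K hK using fun t => OperatorBochner.exists_hasIntegral μ
      (OperatorBochner.measurable_expChar t) (C := 1)
      fun x => by simp [OperatorBochner.norm_expChar]
    have hcomp := OperatorBochner.completelyPositiveDefinite_of_hasIntegral hK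
    refine ⟨K, fun t S => ⟨fun hS => OperatorBochner.ext_inner_self fun v => ?_, ?_⟩,
      fun t => (hK t).isTraceClass, hcomp.weaklyPositiveDefinite, hcomp⟩
    · rw [hS.inner_eq_charFun, (hK t).inner_eq_charFun]
    · rintro rfl
      exact hK t
  · obtain ⟨μ, hμ, -⟩ := OperatorBochner.existsUnique_measure (htr 0) hK hc
    exact OperatorBochner.completelyPositiveDefinite_of_hasIntegral hμ
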